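/- Let $M,a,Q,m,e\in\mathbb R$ with $M>0$ and $a^2+Q^2\le M^2$ (a Kerr–Newman black hole, extreme or non-extreme, and a particle of mass $m$ and charge $e$). Put $\Delta(r)=r^2-2Mr+a^2+Q^2$ and let $r_+=M+\sqrt{M^2-a^2-Q^2}$ be its largest zero. Let $x\in(-\infty,\infty)$ be a radial coordinate with $\frac{dx}{dr}=\frac{r^2+a^2}{\Delta(r)}$ on $(r_+,\infty)$ (with any constant of integration), and let $r=r(x)$ be its inverse. Let $\Omega_2=(-\infty,\infty)\times(0,\pi)$, with coordinates $(x,\theta)$, and $\Omega_{2,R}=(-R,R)\times(0,\pi)$. Let $\sigma_1=\begin{pmatrix}0&1\\1&0\end{pmatrix}$, $\sigma_2=\begin{pmatrix}0&-i\\i&0\end{pmatrix}$, $\sigma_3=\begin{pmatrix}1&0\\0&-1\end{pmatrix}$, let $I$ and $I_2$ be the $4\times4$ and $2\times2$ identity matrices, and $$\mathcal S(x,\theta)=I+\frac{a\sqrt{\Delta}\sin\theta}{r^2+a^2}\begin{pmatrix}\sigma_2&0\\0&-\sigma_2\end{pmatrix}.$$ For measurable $U\subseteq\Omega_2$ let $\mathscr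 L^2_{\mathcal S}(U)^4$ be the space $\mathscr L^2(U)^4$ with the (equivalent) norm $\|\Psi\|_{\mathcal S}=\bigl(\int_U\langle\Psi,\mathcal S\Psi\rangle_{\mathbb C^4}\,dx\,d\theta\bigr)^{1/2}$; the norm $\|\cdot\|_{\mathcal S}$ without further specification is the one with $U=\Omega_2$. For $\kappa\in\mathbb Z+\frac12$ let $$\mathfrak h_1^{(\kappa)}=-\sigma_3\, i\frac{\partial}{\partial x}-\frac{\sqrt\Delta}{r^2+a^2}\Bigl(\sigma_1\, i\frac{\partial}{\partial\theta}+\sigma_2\frac{\kappa}{\sin\theta}\Bigr),$$ $$\mathfrak H^{(\kappa)}=\begin{pmatrix}\mathfrak h_1^{(\kappa)}&0\\0&-\mathfrak h_1^{(\kappa)}\end{pmatrix}-\frac{a\kappa+eQr}{r^2+a^2}\,I-\frac{mr\sqrt\Delta}{r^2+a^2}\begin{pmatrix}0&I_2\\I_2&0\end{pmatrix}+\frac{am\sqrt\Delta\cos\theta}{r^2+a^2}\begin{pmatrix}0&iI_2\\-iI_2&0\end{pmatrix},$$ and let $H^{(\kappa)}$ be the closure in $\mathscr L^2(\Omega_2)^4$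 of the operator $\Psi\mapsto\mathfrak H^{(\kappa)}\Psi$ with domain $\mathscr C_0^\infty(\Omega_2)^4$. **Theorem (Rellich property).** Let $\kappa\in\mathbb Z+\frac12$ and $R>0$. Let $(\Psi_n)_{n\in\mathbb N}\subset\mathcal D(H^{(\kappa)})$ and suppose that there is a constant $K_0>0$ with $$\|\Psi_n\|_{\mathcal S}+\|H^{(\kappa)}\Psi_n\|_{\mathcal S}\le K_0,\qquad n\in\mathbb N.$$ Then there exist a subsequence $(\Psi_{n_\ell})_\ell$ and a $\Phi\in\mathscr L^2(\Omega_{2,R})^4$ such that the restrictions of $\Psi_{n_\ell}$ to $\Omega_{2,R}$ converge to $\Phi$ in $\mathscr L^2_{\mathcal S}(\Omega_{2,R})^4$ as $\ell\to\infty$. -/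

import Mathlib

open Real Set Filter Topology MeasureTheory
open scoped ContDiff

noncomputable section

namespace KerrNewman

/-- Mass `M`, angular momentum parameter `a` and charge `Q` of the black hole, mass `m` and
charge `e` of the particle, and the radius `r₀` at which the coordinate `x` vanishes
(the constant of integration in `dx/dr = (r² + a²) / Δ`). -/
structure Params where
  M : ℝ
  a : ℝ
  Q : ℝ
  m : ℝ
  e : ℝ
  r₀ : ℝ

/-- `Δ(r) = r² - 2 M r + a² + Q²`. -/
def Delta (p : Params) (r : ℝ) : ℝ := r ^ 2 - 2 * p.M * r + p.a ^ 2 + p.Q ^ 2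

/-- The largest zero of `Δ`. -/
def rPlus (p : Params) : ℝ := p.M + √(p.M ^ 2 - p.a ^ 2 - p.Q ^ 2)

/-- Standing assumptions: a black hole of positive mass (extreme or non-extreme), and `r₀`
a point of the exterior region. -/
structure Params.Admissible (p : Params) : Prop where
  mass_pos : 0 < p.M
  blackHole : p.a ^ 2 + p.Q ^ 2 ≤ p.M ^ 2
  rPlus_lt : rPlus p < p.r₀

/-- The radial coordinate `x` as a function of `r ∈ (r₊, ∞)`: the antiderivative of
`(r² + a²) / Δ(r)` that vanishes at `r₀`. -/
def tortoise (p : Params) (r : ℝ) : ℝ :=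
  ∫ s in p.r₀..r, (s ^ 2 + p.a ^ 2) / Delta p s

/-- `r(x)`, the inverse of `tortoise : (r₊, ∞) → ℝ`. -/
def radius (p : Params) (x : ℝ) : ℝ :=
  Function.invFunOn (tortoise p) (Ioi (rPlus p)) x

theorem Delta_eq (p : Params) (hp : p.Admissible) (s : ℝ) :
    Delta p s = (s - rPlus p) * (s - rPlus p + 2 * √(p.M ^ 2 - p.a ^ 2 - p.Q ^ 2)) := by
  have h := Real.sq_sqrt (show 0 ≤ p.M ^ 2 - p.a ^ 2 - p.Q ^ 2 by linarith [hp.blackHole])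
  unfold Delta rPlus
  linear_combination h

theorem mass_le_rPlus (p : Params) : p.M ≤ rPlus p := by
  unfold rPlus
  linarith [Real.sqrt_nonneg (p.M ^ 2 - p.a ^ 2 - p.Q ^ 2)]

theorem Delta_pos (p : Params) (hp : p.Admissible) {s : ℝ} (hs : rPlus p < s) :
    0 < Delta p s := by
  rw [Delta_eq p hp]
  have := Real.sqrt_nonneg (p.M ^ 2 - p.a ^ 2 - p.Q ^ 2)
  exact mul_pos (by linarith) (by linarith)

theorem Delta_le (p : Params) (hp : p.Admissible) {s : ℝ} (hs : rPlus p < s) :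
    Delta p s ≤ s ^ 2 + p.a ^ 2 := by
  have h1 := mass_le_rPlus p
  have h2 := hp.mass_pos
  have h3 := hp.blackHole
  unfold Delta
  nlinarith [sq_nonneg p.a]

theorem continuous_Delta (p : Params) : Continuous (Delta p) := by
  unfold Delta
  fun_prop

theorem continuousOn_integrand (p : Params) (hp : p.Admissible) :
    ContinuousOn (fun s => (s ^ 2 + p.a ^ 2) / Delta p s) (Ioi (rPlus p)) :=
  ContinuousOn.div (by fun_prop) (continuous_Delta p).continuousOn
    fun _ hs => (Delta_pos p hp hs).ne'

theorem hasDerivAt_tortoise (p : Params) (hp : p.Admissible) {r : ℝ} (hr : rPlus p < r) :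
    HasDerivAt (tortoise p) ((r ^ 2 + p.a ^ 2) / Delta p r) r := by
  have hc := continuousOn_integrand p hp
  have hsub : uIcc p.r₀ r ⊆ Ioi (rPlus p) :=
    (ordConnected_Ioi).uIcc_subset hp.rPlus_lt hr
  exact intervalIntegral.integral_hasDerivAt_right (hc.mono hsub).intervalIntegrable
    (hc.stronglyMeasurableAtFilter isOpen_Ioi r hr) (hc.continuousAt (Ioi_mem_nhds hr))

theorem strictMonoOn_tortoise (p : Params) (hp : p.Admissible) :
    StrictMonoOn (tortoise p) (Ioi (rPlus p)) := by
  refine strictMonoOn_of_deriv_pos (convex_Ioi _)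
    (fun r hr => (hasDerivAt_tortoise p hp hr).continuousAt.continuousWithinAt) fun r hr => ?_
  rw [interior_Ioi] at hr
  rw [(hasDerivAt_tortoise p hp hr).deriv]
  have := Delta_pos p hp hr
  have := Delta_le p hp hr
  apply div_pos <;> linarith

theorem tendsto_tortoise_atTop (p : Params) (hp : p.Admissible) :
    Tendsto (tortoise p) atTop atTop := by
  have hd : ∀ r ∈ Ioi (rPlus p), HasDerivAt (fun r => tortoise p r - r)
      ((r ^ 2 + p.a ^ 2) / Delta p r - 1) r :=
    fun r hr => (hasDerivAt_tortoise p hp hr).sub (hasDerivAt_id r)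
  have hm : MonotoneOn (fun r => tortoise p r - r) (Ioi (rPlus p)) := by
    refine monotoneOn_of_deriv_nonneg (convex_Ioi _)
      (fun r hr => (hd r hr).continuousAt.continuousWithinAt) ?_ fun r hr => ?_
    · rw [interior_Ioi]
      exact fun r hr => (hd r hr).differentiableAt.differentiableWithinAt
    rw [interior_Ioi] at hr
    rw [(hd r hr).deriv, sub_nonneg, le_div_iff₀ (Delta_pos p hp hr), one_mul]
    exact Delta_le p hp hr
  refine tendsto_atTop_mono' atTop (f₁ := fun r => r + (tortoise p p.r₀ - p.r₀)) ?_
    (tendsto_atTop_add_const_right _ _ tendsto_id)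
  filter_upwards [eventually_ge_atTop p.r₀] with r hr
  have : tortoise p p.r₀ - p.r₀ ≤ tortoise p r - r :=
    hm hp.rPlus_lt (hp.rPlus_lt.trans_le hr) hr
  linarith

theorem tendsto_tortoise_rPlus (p : Params) (hp : p.Admissible) :
    Tendsto (tortoise p) (𝓝[>] rPlus p) atBot := by
  have hM := hp.mass_pos
  have hsq := Real.sqrt_nonneg (p.M ^ 2 - p.a ^ 2 - p.Q ^ 2)
  have h0 := hp.rPlus_lt
  set d := p.r₀ - rPlus p + 2 * √(p.M ^ 2 - p.a ^ 2 - p.Q ^ 2) with hd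
  have hdpos : 0 < d := by linarith
  set c := p.M ^ 2 / d with hc
  have hcpos : 0 < c := by positivity
  have hder : ∀ r ∈ Ioc (rPlus p) p.r₀, HasDerivAt (fun r => tortoise p r - c * log (r - rPlus p))
      ((r ^ 2 + p.a ^ 2) / Delta p r - c * (1 / (r - rPlus p))) r := by
    intro r hr
    refine (hasDerivAt_tortoise p hp hr.1).sub (HasDerivAt.const_mul c ?_)
    exact ((hasDerivAt_id r).sub_const _).log (sub_pos.2 hr.1).ne'
  have hm : MonotoneOn (fun r => tortoise p r - c * log (r - rPlus p)) (Ioc (rPlus p) p.r₀) := by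
    refine monotoneOn_of_deriv_nonneg (convex_Ioc _ _)
      (fun r hr => (hder r hr).continuousAt.continuousWithinAt) ?_ fun r hr => ?_
    · exact fun r hr => (hder r (interior_subset hr)).differentiableAt.differentiableWithinAt
    have hr' := interior_subset hr
    rw [(hder r hr').deriv, sub_nonneg, le_div_iff₀ (Delta_pos p hp hr'.1), Delta_eq p hp]
    have h1 : 0 < r - rPlus p := sub_pos.2 hr'.1
    have h2 : c * (1 / (r - rPlus p)) * ((r - rPlus p) *
        (r - rPlus p + 2 * √(p.M ^ 2 - p.a ^ 2 - p.Q ^ 2))) =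
        c * (r - rPlus p + 2 * √(p.M ^ 2 - p.a ^ 2 - p.Q ^ 2)) := by
      field_simp
    rw [h2]
    calc c * (r - rPlus p + 2 * √(p.M ^ 2 - p.a ^ 2 - p.Q ^ 2)) ≤ c * d := by
          apply mul_le_mul_of_nonneg_left _ hcpos.le
          linarith [hr'.2]
      _ = p.M ^ 2 := by rw [hc]; field_simp
      _ ≤ r ^ 2 + p.a ^ 2 := by nlinarith [mass_le_rPlus p, sq_nonneg p.a]
  have hlog : Tendsto (fun r => c * log (r - rPlus p)) (𝓝[>] rPlus p) atBot := by
    refine Tendsto.const_mul_atBot hcpos (Real.tendsto_log_nhdsGT_zero.comp ?_)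
    refine tendsto_nhdsWithin_iff.2 ⟨?_, ?_⟩
    · have : Tendsto (fun r => r - rPlus p) (𝓝 (rPlus p)) (𝓝 (rPlus p - rPlus p)) :=
        (continuous_id.sub continuous_const).tendsto _
      rw [sub_self] at this
      exact this.mono_left nhdsWithin_le_nhds
    · filter_upwards [self_mem_nhdsWithin] with r hr using sub_pos.2 (mem_Ioi.1 hr)
  refine tendsto_atBot_mono' _ ?_ (tendsto_atBot_add_const_right _
    (tortoise p p.r₀ - c * log (p.r₀ - rPlus p)) hlog)
  filter_upwards [Ioc_mem_nhdsGT h0] with r hr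
  have : tortoise p r - c * log (r - rPlus p) ≤ tortoise p p.r₀ - c * log (p.r₀ - rPlus p) :=
    hm hr ⟨h0, le_rfl⟩ hr.2
  linarith

theorem surjOn_tortoise (p : Params) (hp : p.Admissible) :
    SurjOn (tortoise p) (Ioi (rPlus p)) univ :=
  isPreconnected_Ioi.intermediate_value_Iii (l₁ := 𝓝[>] rPlus p) (l₂ := atTop)
    inf_le_right (le_principal_iff.2 (Ioi_mem_atTop _))
    (fun _ hr => (hasDerivAt_tortoise p hp hr).continuousAt.continuousWithinAt)
    (tendsto_tortoise_rPlus p hp) (tendsto_tortoise_atTop p hp)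

theorem rPlus_lt_radius (p : Params) (hp : p.Admissible) (x : ℝ) : rPlus p < radius p x :=
  Function.invFunOn_mem (surjOn_tortoise p hp (mem_univ x))

theorem tortoise_radius (p : Params) (hp : p.Admissible) (x : ℝ) :
    tortoise p (radius p x) = x :=
  Function.invFunOn_eq (surjOn_tortoise p hp (mem_univ x))

theorem radius_tortoise (p : Params) (hp : p.Admissible) {r : ℝ} (hr : rPlus p < r) :
    radius p (tortoise p r) = r :=
  (strictMonoOn_tortoise p hp).injOn (rPlus_lt_radius p hp _) hr (tortoise_radius p hp _)

/-- `dr/dx = Δ / (r² + a²)` on the whole line. -/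
theorem hasDerivAt_radius (p : Params) (hp : p.Admissible) (x : ℝ) :
    HasDerivAt (radius p) (Delta p (radius p x) / (radius p x ^ 2 + p.a ^ 2)) x := by
  have hmono : Monotone (radius p) := by
    intro x y hxy
    by_contra! h
    have := strictMonoOn_tortoise p hp (rPlus_lt_radius p hp y) (rPlus_lt_radius p hp x) h
    rw [tortoise_radius p hp, tortoise_radius p hp] at this
    exact absurd this (not_lt.2 hxy)
  have hcont : ContinuousAt (radius p) x := by
    refine continuousAt_of_monotoneOn_of_image_mem_nhds (hmono.monotoneOn univ) univ_mem ?_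
    refine mem_of_superset (Ioi_mem_nhds (rPlus_lt_radius p hp x)) fun r hr => ?_
    exact ⟨tortoise p r, mem_univ _, radius_tortoise p hp hr⟩
  have hr := rPlus_lt_radius p hp x
  have h1 := Delta_pos p hp hr
  have h2 := Delta_le p hp hr
  have := HasDerivAt.of_local_left_inverse hcont (hasDerivAt_tortoise p hp hr)
    (div_pos (h1.trans_le h2) h1).ne' (Eventually.of_forall (tortoise_radius p hp))
  rwa [inv_div] at this

/-- `√Δ / (r² + a²)` at `r = r(x)`. -/
def weight (p : Params) (x : ℝ) : ℝ :=
  √(Delta p (radius p x)) / (radius p x ^ 2 + p.a ^ 2)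

def σ₁ : Matrix (Fin 2) (Fin 2) ℂ := !![0, 1; 1, 0]
def σ₂ : Matrix (Fin 2) (Fin 2) ℂ := !![0, -Complex.I; Complex.I, 0]
def σ₃ : Matrix (Fin 2) (Fin 2) ℂ := !![1, 0; 0, -1]

/-- `ℂ⁴ = ℂ² ⊕ ℂ²` with its Euclidean inner product. -/
abbrev Spinor := EuclideanSpace ℂ (Fin 2 ⊕ Fin 2)

abbrev Mat4 := Matrix (Fin 2 ⊕ Fin 2) (Fin 2 ⊕ Fin 2) ℂ

/-- The block matrix `diag(A, -A)`. -/
def pm (A : Matrix (Fin 2) (Fin 2) ℂ) : Mat4 := Matrix.fromBlocks A 0 0 (-A)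

/-- The action of a `4 × 4` matrix on `ℂ⁴`. -/
def act (A : Mat4) (v : Spinor) : Spinor := Matrix.toEuclideanCLM (𝕜 := ℂ) A v

/-- `Ω₂ = (-∞, ∞) × (0, π)`. -/
def Ω₂ : Set (ℝ × ℝ) := univ ×ˢ Ioo 0 π

/-- `Ω_{2,R} = (-R, R) × (0, π)`. -/
def Ω₂R (R : ℝ) : Set (ℝ × ℝ) := Ioo (-R) R ×ˢ Ioo 0 π

/-- The matrix `𝒮(x, θ)`. -/
def S (p : Params) (y : ℝ × ℝ) : Mat4 :=
  1 + ((p.a * weight p y.1 * sin y.2 : ℝ) : ℂ) • pm σ₂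

/-- The norm `‖u‖_𝒮` in `L²_𝒮(U)⁴`, that is `(∫_U ⟨u, 𝒮 u⟩)^{1/2}`. -/
def normS (p : Params) (U : Set (ℝ × ℝ)) (u : ℝ × ℝ → Spinor) : ℝ :=
  √(∫ y in U, (inner ℂ (u y) (act (S p y) (u y))).re)

/-- The first order part of the formal partial wave Dirac operator:
`diag(h, -h)` with `h = -σ₃ i∂ₓ - √Δ/(r² + a²) (σ₁ i∂_θ + σ₂ κ / sin θ)`. -/
def dirac₁ (p : Params) (κ : ℝ) (u : ℝ × ℝ → Spinor) (y : ℝ × ℝ) : Spinor :=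
  -act (pm σ₃) (Complex.I • fderiv ℝ u y (1, 0))
    - (weight p y.1 : ℂ) • (act (pm σ₁) (Complex.I • fderiv ℝ u y (0, 1))
      + ((κ / sin y.2 : ℝ) : ℂ) • act (pm σ₂) (u y))

/-- The zeroth order part of the formal partial wave Dirac operator, a Hermitian matrix. -/
def potential (p : Params) (κ : ℝ) (y : ℝ × ℝ) : Mat4 :=
  -(((p.a * κ + p.e * p.Q * radius p y.1) / (radius p y.1 ^ 2 + p.a ^ 2) : ℝ) : ℂ) • (1 : Mat4)
    - ((p.m * radius p y.1 * weight p y.1 : ℝ) : ℂ) • Matrix.fromBlocks 0 1 1 0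
    + ((p.a * p.m * weight p y.1 * cos y.2 : ℝ) : ℂ) •
      Matrix.fromBlocks 0 (Complex.I • 1) (-Complex.I • 1) 0

/-- The formal partial wave Dirac operator. -/
def dirac (p : Params) (κ : ℝ) (u : ℝ × ℝ → Spinor) (y : ℝ × ℝ) : Spinor :=
  dirac₁ p κ u y + act (potential p κ y) (u y)

/-- `u ∈ C₀^∞(Ω₂)⁴`. -/
structure IsTest (u : ℝ × ℝ → Spinor) : Prop where
  contDiff : ContDiff ℝ ∞ u
  hasCompactSupport : HasCompactSupport u
  tsupport_subset : tsupport u ⊆ Ω₂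

/-- The Hilbert space `L²(Ω₂)⁴`. -/
abbrev L2 := Lp Spinor 2 (volume.restrict Ω₂)

theorem act_add (A : Mat4) (v w : Spinor) : act A (v + w) = act A v + act A w := map_add _ v w

theorem act_smul (A : Mat4) (c : ℂ) (v : Spinor) : act A (c • v) = c • act A v := map_smul _ c v

theorem act_zero (A : Mat4) : act A 0 = 0 := map_zero _

theorem IsTest.zero : IsTest 0 where
  contDiff := contDiff_const
  hasCompactSupport := HasCompactSupport.zero
  tsupport_subset := by simp [tsupport]

theorem IsTest.add {u v : ℝ × ℝ → Spinor} (hu : IsTest u) (hv : IsTest v) : IsTest (u + v) where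
  contDiff := hu.contDiff.add hv.contDiff
  hasCompactSupport := hu.hasCompactSupport.add hv.hasCompactSupport
  tsupport_subset := (tsupport_add u v).trans (union_subset hu.tsupport_subset hv.tsupport_subset)

theorem IsTest.smul {u : ℝ × ℝ → Spinor} (c : ℂ) (hu : IsTest u) : IsTest (c • u) where
  contDiff := hu.contDiff.const_smul c
  hasCompactSupport := hu.hasCompactSupport.smul_left (f := fun _ => c)
  tsupport_subset := (tsupport_smul_subset_right (fun _ => c) u).trans hu.tsupport_subset

theorem IsTest.differentiable {u : ℝ × ℝ → Spinor} (hu : IsTest u) : Differentiable ℝ u :=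
  hu.contDiff.differentiable (by simp)

theorem dirac_zero (p : Params) (κ : ℝ) : dirac p κ 0 = 0 := by
  ext1 y
  simp [dirac, dirac₁, act_zero]

theorem dirac_add (p : Params) (κ : ℝ) {u v : ℝ × ℝ → Spinor} (hu : IsTest u) (hv : IsTest v) :
    dirac p κ (u + v) = dirac p κ u + dirac p κ v := by
  ext1 y
  simp only [dirac, dirac₁, fderiv_add (hu.differentiable y) (hv.differentiable y), Pi.add_apply,
    _root_.add_apply, smul_add, act_add]
  module

theorem dirac_smul (p : Params) (κ : ℝ) (c : ℂ) {u : ℝ × ℝ → Spinor} (hu : IsTest u) :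
    dirac p κ (c • u) = c • dirac p κ u := by
  ext1 y
  simp only [dirac, dirac₁, fderiv_const_smul (hu.differentiable y), Pi.smul_apply,
    _root_.smul_apply, act_smul, smul_comm _ c]
  module

/-- The graph of the minimal operator: the pairs `(u, 𝔥 u)` with `u ∈ C₀^∞(Ω₂)⁴`. -/
def minimalGraph (p : Params) (κ : ℝ) : Submodule ℂ (L2 × L2) where
  carrier := {f | ∃ u, IsTest u ∧ f.1 =ᵐ[volume.restrict Ω₂] u ∧
    f.2 =ᵐ[volume.restrict Ω₂] dirac p κ u}
  zero_mem' := ⟨0, IsTest.zero, Lp.coeFn_zero _ _ _, by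
    rw [dirac_zero]; exact Lp.coeFn_zero _ _ _⟩
  add_mem' := by
    rintro f g ⟨u, hu, h1, h2⟩ ⟨v, hv, h3, h4⟩
    refine ⟨u + v, hu.add hv, (Lp.coeFn_add _ _).trans (h1.add h3), ?_⟩
    rw [dirac_add p κ hu hv]
    exact (Lp.coeFn_add _ _).trans (h2.add h4)
  smul_mem' := by
    rintro c f ⟨u, hu, h1, h2⟩
    refine ⟨c • u, hu.smul c, (Lp.coeFn_smul _ _).trans (h1.const_smul c), ?_⟩
    rw [dirac_smul p κ c hu]
    exact (Lp.coeFn_smul _ _).trans (h2.const_smul c)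

/-- The minimal operator, with domain `C₀^∞(Ω₂)⁴`, in `L²(Ω₂)⁴`. -/
def minimalDirac (p : Params) (κ : ℝ) : L2 →ₗ.[ℂ] L2 := (minimalGraph p κ).toLinearPMap

/-- The partial wave Dirac operator `H^{(κ)}`: the closure of the minimal operator (see
`diracOp_graph` below). -/
def diracOp (p : Params) (κ : ℝ) : L2 →ₗ.[ℂ] L2 := (minimalDirac p κ).closure

theorem isOpen_Ω₂ : IsOpen Ω₂ := isOpen_univ.prod isOpen_Ioo

theorem continuous_radius (p : Params) (hp : p.Admissible) : Continuous (radius p) :=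
  continuous_iff_continuousAt.2 fun x => (hasDerivAt_radius p hp x).continuousAt

theorem radius_sq_add_pos (p : Params) (hp : p.Admissible) (x : ℝ) :
    0 < radius p x ^ 2 + p.a ^ 2 :=
  (Delta_pos p hp (rPlus_lt_radius p hp x)).trans_le (Delta_le p hp (rPlus_lt_radius p hp x))

theorem continuous_weight (p : Params) (hp : p.Admissible) : Continuous (weight p) := by
  have hr := continuous_radius p hp
  unfold weight
  exact (((continuous_Delta p).comp hr).sqrt).div (by fun_prop)
    fun x => (radius_sq_add_pos p hp x).ne'

theorem continuous_act (A : Mat4) : Continuous (act A) :=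
  (Matrix.toEuclideanCLM (𝕜 := ℂ) A).continuous

theorem inner_act (A : Mat4) (v w : Spinor) :
    inner ℂ (act A v) w = inner ℂ v (act A.conjTranspose w) := by
  have h : Matrix.toEuclideanCLM (𝕜 := ℂ) A.conjTranspose
      = ContinuousLinearMap.adjoint (Matrix.toEuclideanCLM (𝕜 := ℂ) A) := by
    rw [← ContinuousLinearMap.star_eq_adjoint, ← map_star]
    rfl
  unfold act
  rw [h, ContinuousLinearMap.adjoint_inner_right]

theorem act_add_mat (A B : Mat4) (v : Spinor) : act (A + B) v = act A v + act B v := by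
  simp [act]

theorem act_sub_mat (A B : Mat4) (v : Spinor) : act (A - B) v = act A v - act B v := by
  simp [act]

theorem act_smul_mat (c : ℂ) (A : Mat4) (v : Spinor) : act (c • A) v = c • act A v := by
  simp [act]

theorem pm_conjTranspose {A : Matrix (Fin 2) (Fin 2) ℂ} (hA : A.conjTranspose = A) :
    (pm A).conjTranspose = pm A := by
  simp [pm, Matrix.fromBlocks_conjTranspose, hA]

theorem σ₁_conjTranspose : σ₁.conjTranspose = σ₁ := by
  ext i j; fin_cases i <;> fin_cases j <;> simp [σ₁]

theorem σ₂_conjTranspose : σ₂.conjTranspose = σ₂ := by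
  ext i j; fin_cases i <;> fin_cases j <;> simp [σ₂]

theorem σ₃_conjTranspose : σ₃.conjTranspose = σ₃ := by
  ext i j; fin_cases i <;> fin_cases j <;> simp [σ₃]

theorem potential_conjTranspose (p : Params) (κ : ℝ) (y : ℝ × ℝ) :
    (potential p κ y).conjTranspose = potential p κ y := by
  simp [potential, Matrix.conjTranspose_smul, Matrix.fromBlocks_conjTranspose,
    -Complex.ofReal_cos]

/-- `𝔥 u` vanishes outside the support of `u`. -/
theorem dirac_eq_zero (p : Params) (κ : ℝ) {u : ℝ × ℝ → Spinor} {y : ℝ × ℝ}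
    (hy : y ∉ tsupport u) : dirac p κ u y = 0 := by
  have h1 : u y = 0 := image_eq_zero_of_notMem_tsupport hy
  have h2 : fderiv ℝ u y = 0 := by
    have := support_fderiv_subset ℝ (f := u)
    by_contra h
    exact hy (this h)
  simp [dirac, dirac₁, h1, h2, act_zero]

theorem tsupport_dirac_subset (p : Params) (κ : ℝ) (u : ℝ × ℝ → Spinor) :
    tsupport (dirac p κ u) ⊆ tsupport u :=
  closure_minimal (fun y hy => by_contra fun h => hy (dirac_eq_zero p κ h))
    (isClosed_tsupport u)

theorem continuous_dirac (p : Params) (hp : p.Admissible) (κ : ℝ) {u : ℝ × ℝ → Spinor}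
    (hu : IsTest u) : Continuous (dirac p κ u) := by
  have hr := continuous_radius p hp
  have hw := continuous_weight p hp
  have hr0 := fun x => (radius_sq_add_pos p hp x).ne'
  have hd : Continuous (fderiv ℝ u) := hu.contDiff.continuous_fderiv (by simp)
  have huc := hu.contDiff.continuous
  have ha := continuous_act
  refine ContinuousOn.continuous_of_tsupport_subset ?_ isOpen_Ω₂
    ((tsupport_dirac_subset p κ u).trans hu.tsupport_subset)
  have hsin : ContinuousOn (fun y : ℝ × ℝ => ((κ / sin y.2 : ℝ) : ℂ)) Ω₂ :=
    Complex.continuous_ofReal.comp_continuousOn (ContinuousOn.div (by fun_prop) (by fun_prop)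
      fun y hy => (sin_pos_of_mem_Ioo hy.2).ne')
  have hdiv : Continuous fun y : ℝ × ℝ =>
      (((p.a * κ + p.e * p.Q * radius p y.1) / (radius p y.1 ^ 2 + p.a ^ 2) : ℝ) : ℂ) :=
    Complex.continuous_ofReal.comp (Continuous.div (by fun_prop) (by fun_prop) fun _ => hr0 _)
  have hpot : Continuous fun y => act (potential p κ y) (u y) := by
    simp only [potential, act_add_mat, act_sub_mat, act_smul_mat]
    fun_prop
  have hsu : ContinuousOn (fun y => ((κ / sin y.2 : ℝ) : ℂ) • act (pm σ₂) (u y)) Ω₂ :=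
    hsin.smul ((ha _).comp huc).continuousOn
  have h3 : Continuous fun y => -act (pm σ₃) (Complex.I • fderiv ℝ u y (1, 0)) := by fun_prop
  have h1 : Continuous fun y => act (pm σ₁) (Complex.I • fderiv ℝ u y (0, 1)) := by fun_prop
  have hwc : Continuous fun y : ℝ × ℝ => (weight p y.1 : ℂ) := by fun_prop
  exact (h3.continuousOn.sub (hwc.continuousOn.smul (h1.continuousOn.add hsu))).add
    hpot.continuousOn

theorem IsTest.memLp {u : ℝ × ℝ → Spinor} (hu : IsTest u) : MemLp u 2 (volume.restrict Ω₂) :=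
  (hu.contDiff.continuous.memLp_of_hasCompactSupport hu.hasCompactSupport).restrict _

theorem hasCompactSupport_dirac (p : Params) (κ : ℝ) {u : ℝ × ℝ → Spinor} (hu : IsTest u) :
    HasCompactSupport (dirac p κ u) :=
  hu.hasCompactSupport.of_isClosed_subset (isClosed_tsupport _) (tsupport_dirac_subset p κ u)

theorem memLp_dirac (p : Params) (hp : p.Admissible) (κ : ℝ) {u : ℝ × ℝ → Spinor}
    (hu : IsTest u) : MemLp (dirac p κ u) 2 (volume.restrict Ω₂) :=
  ((continuous_dirac p hp κ hu).memLp_of_hasCompactSupport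
    (hasCompactSupport_dirac p κ hu)).restrict _

/-- The divergence theorem for a compactly supported function, in one direction. -/
theorem integral_lineDeriv_eq_zero {g g' : ℝ × ℝ → ℂ} {v : ℝ × ℝ} (hg : Integrable g)
    (hg' : Integrable g') (h : ∀ y, HasLineDerivAt ℝ g (g' y) y v) : ∫ y, g' y = 0 := by
  have := integral_bilinear_hasLineDerivAt_right_eq_neg_left_of_integrable (μ := volume)
    (f := fun _ : ℝ × ℝ => (1 : ℂ)) (f' := fun _ => 0) (g := g) (g' := g') (v := v)
    (B := ContinuousLinearMap.mul ℝ ℂ) (by simp) (by simpa using hg') (by simpa using hg)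
    (fun y _ => by simpa using (hasFDerivAt_const (1 : ℂ) y).hasLineDerivAt v) (fun y _ => h y)
  simpa using this

theorem hasLineDerivAt_pair {u v : ℝ × ℝ → Spinor} (hu : IsTest u) (hv : IsTest v) (A : Mat4)
    (y d : ℝ × ℝ) : HasLineDerivAt ℝ (fun y => inner ℂ (u y) (act A (v y)))
      (inner ℂ (u y) (act A (fderiv ℝ v y d)) + inner ℂ (fderiv ℝ u y d) (act A (v y))) y d := by
  have h1 := (hu.differentiable y).hasFDerivAt
  have h2 : HasFDerivAt (fun y => act A (v y)) (((Matrix.toEuclideanCLM (𝕜 := ℂ) A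
      : Spinor →L[ℂ] Spinor).restrictScalars ℝ).comp (fderiv ℝ v y)) y :=
    ((Matrix.toEuclideanCLM (𝕜 := ℂ) A : Spinor →L[ℂ] Spinor).restrictScalars ℝ).hasFDerivAt.comp
      y (hv.differentiable y).hasFDerivAt
  exact (h1.inner ℂ h2).hasLineDerivAt d

theorem inner_dirac_sub (p : Params) (κ : ℝ) (u v : ℝ × ℝ → Spinor) (y : ℝ × ℝ) :
    inner ℂ (dirac p κ u y) (v y) - inner ℂ (u y) (dirac p κ v y) =
      Complex.I * (inner ℂ (u y) (act (pm σ₃) (fderiv ℝ v y (1, 0)))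
        + inner ℂ (fderiv ℝ u y (1, 0)) (act (pm σ₃) (v y)))
      + Complex.I * ((weight p y.1 : ℂ) * (inner ℂ (u y) (act (pm σ₁) (fderiv ℝ v y (0, 1)))
        + inner ℂ (fderiv ℝ u y (0, 1)) (act (pm σ₁) (v y)))) := by
  simp only [dirac, dirac₁, inner_add_left, inner_add_right, inner_sub_left, inner_sub_right,
    inner_neg_left, inner_neg_right, inner_smul_left, inner_smul_right, inner_act,
    pm_conjTranspose σ₁_conjTranspose, pm_conjTranspose σ₂_conjTranspose,
    pm_conjTranspose σ₃_conjTranspose, potential_conjTranspose, act_smul, Complex.conj_ofReal,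
    Complex.conj_I]
  ring

/-- The minimal operator is symmetric. -/
theorem integral_inner_dirac (p : Params) (hp : p.Admissible) (κ : ℝ) {u v : ℝ × ℝ → Spinor}
    (hu : IsTest u) (hv : IsTest v) :
    ∫ y, inner ℂ (dirac p κ u y) (v y) = ∫ y, inner ℂ (u y) (dirac p κ v y) := by
  have huc := hu.contDiff.continuous
  have hvc := hv.contDiff.continuous
  have hw := continuous_weight p hp
  have ha := continuous_act
  have hdu : Continuous (fderiv ℝ u) := hu.contDiff.continuous_fderiv (by simp)
  have hdv : Continuous (fderiv ℝ v) := hv.contDiff.continuous_fderiv (by simp)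
  have hcs : ∀ f : ℝ × ℝ → ℂ, Continuous f → (∀ y, y ∉ tsupport u → f y = 0) → Integrable f :=
    fun f hf h => hf.integrable_of_hasCompactSupport
      (HasCompactSupport.intro hu.hasCompactSupport h)
  have hu0 : ∀ y, y ∉ tsupport u → u y = 0 := fun y hy => image_eq_zero_of_notMem_tsupport hy
  have hdu0 : ∀ y, y ∉ tsupport u → fderiv ℝ u y = 0 := fun y hy => by
    by_contra h
    exact hy (support_fderiv_subset ℝ (f := u) h)
  have i1 := hcs (fun y => inner ℂ (dirac p κ u y) (v y))
    ((continuous_dirac p hp κ hu).inner hvc) (fun y hy => by simp [dirac_eq_zero p κ hy])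
  have i2 := hcs (fun y => inner ℂ (u y) (dirac p κ v y))
    (huc.inner (continuous_dirac p hp κ hv)) (fun y hy => by simp [hu0 y hy])
  have i3 : ∀ (A : Mat4) (d : ℝ × ℝ), Continuous (fun y => inner ℂ (u y) (act A (fderiv ℝ v y d))
        + inner ℂ (fderiv ℝ u y d) (act A (v y))) := fun A d =>
    (huc.inner ((ha A).comp (hdv.clm_apply continuous_const))).add
      ((hdu.clm_apply continuous_const).inner ((ha A).comp hvc))
  have i4 : ∀ A : Mat4, Continuous (fun y => inner ℂ (u y) (act A (v y))) := fun A =>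
    huc.inner ((ha A).comp hvc)
  have hwc : Continuous (fun y : ℝ × ℝ => (weight p y.1 : ℂ)) := by fun_prop
  have j1 := hcs _ (i3 (pm σ₃) (1, 0)) (fun y hy => by simp [hu0 y hy, hdu0 y hy])
  have j2 := hcs _ (hwc.mul (i3 (pm σ₁) (0, 1))) (fun y hy => by simp [hu0 y hy, hdu0 y hy])
  have k1 := integral_lineDeriv_eq_zero (hcs _ (i4 (pm σ₃)) (fun y hy => by simp [hu0 y hy])) j1
    (fun y => hasLineDerivAt_pair hu hv (pm σ₃) y (1, 0))
  have k2 := integral_lineDeriv_eq_zero (v := (0, 1))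
    (hcs _ (hwc.mul (i4 (pm σ₁))) (fun y hy => by simp [hu0 y hy])) j2
    (fun y => by
      have h := hasLineDerivAt_pair hu hv (pm σ₁) y (0, 1)
      unfold HasLineDerivAt at h ⊢
      simpa using h.const_mul (weight p y.1 : ℂ))
  rw [← sub_eq_zero, ← integral_sub i1 i2]
  simp_rw [inner_dirac_sub]
  have := integral_add (j1.const_mul Complex.I) (j2.const_mul Complex.I)
  simp only [Pi.mul_apply] at this k2
  rw [this, integral_const_mul, integral_const_mul, k1, k2]
  simp

/-- A square integrable function orthogonal to all test functions vanishes. -/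
theorem eq_zero_of_inner_test (g : L2)
    (h : ∀ v : ℝ × ℝ → Spinor, IsTest v → ∫ y in Ω₂, inner ℂ (v y) (g y) = 0) : g = 0 := by
  have hloc : LocallyIntegrableOn g Ω₂ :=
    locallyIntegrableOn_of_locallyIntegrable_restrict
      ((Lp.memLp g).locallyIntegrable (by norm_num))
  have hae := isOpen_Ω₂.ae_eq_zero_of_integral_contDiff_smul_eq_zero hloc
    (fun φ hφ hc hs => ?_)
  · refine (Lp.eq_zero_iff_ae_eq_zero).2 ?_
    exact (ae_restrict_iff' isOpen_Ω₂.measurableSet).2 hae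
  have hsub : ∀ y, y ∉ Ω₂ → φ y • g y = 0 := fun y hy => by
    rw [image_eq_zero_of_notMem_tsupport fun h' => hy (hs h'), zero_smul]
  have hint : IntegrableOn (fun y => φ y • g y) Ω₂ :=
    LocallyIntegrable.integrable_smul_left_of_hasCompactSupport
      ((Lp.memLp g).locallyIntegrable (by norm_num)) hφ.continuous hc
  rw [← setIntegral_eq_integral_of_forall_compl_eq_zero hsub]
  refine ext_inner_left ℂ fun c => ?_
  rw [inner_zero_right, ← integral_inner hint c]
  have ht : IsTest fun y => φ y • c :=
    ⟨hφ.smul contDiff_const, hc.smul_right, (tsupport_smul_subset_left φ _).trans hs⟩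
  rw [← h _ ht]
  refine integral_congr_ae (Eventually.of_forall fun y => ?_)
  simp only [← Complex.coe_smul, inner_smul_left, inner_smul_right, Complex.conj_ofReal]

theorem inner_toLp (g : L2) {v : ℝ × ℝ → Spinor} (hv : MemLp v 2 (volume.restrict Ω₂)) :
    inner ℂ (hv.toLp v) g = ∫ y in Ω₂, inner ℂ (v y) (g y) := by
  rw [MeasureTheory.L2.inner_def]
  refine integral_congr_ae ?_
  filter_upwards [hv.coeFn_toLp] with y hy
  rw [hy]

/-- The closure of the graph of the minimal operator is the graph of a function. -/
theorem closure_minimalGraph_single (p : Params) (hp : p.Admissible) (κ : ℝ) (f : L2 × L2)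
    (hf : f ∈ (minimalGraph p κ).topologicalClosure) (h0 : f.1 = 0) : f.2 = 0 := by
  refine eq_zero_of_inner_test f.2 fun v hv => ?_
  have key : ∀ f ∈ (minimalGraph p κ).topologicalClosure,
      inner ℂ (hv.memLp.toLp v) f.2 = inner ℂ ((memLp_dirac p hp κ hv).toLp _) f.1 := by
    intro f hf
    have hcl : IsClosed {f : L2 × L2 | inner ℂ (hv.memLp.toLp v) f.2
        = inner ℂ ((memLp_dirac p hp κ hv).toLp _) f.1} :=
      isClosed_eq (by fun_prop) (by fun_prop)
    refine closure_minimal ?_ hcl hf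
    rintro f ⟨u, hu, h1, h2⟩
    have e1 : ∫ y in Ω₂, inner ℂ (v y) (f.2 y) = ∫ y, inner ℂ (v y) (dirac p κ u y) := by
      rw [← setIntegral_eq_integral_of_forall_compl_eq_zero (s := Ω₂)
        (f := fun y => (inner ℂ (v y) (dirac p κ u y) : ℂ)) fun y hy => by
          rw [image_eq_zero_of_notMem_tsupport fun h' => hy (hv.tsupport_subset h'),
            inner_zero_left]]
      refine integral_congr_ae ?_
      filter_upwards [h2] with y hy
      rw [hy]
    have e2 : ∫ y in Ω₂, inner ℂ (dirac p κ v y) (f.1 y)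
        = ∫ y, inner ℂ (dirac p κ v y) (u y) := by
      rw [← setIntegral_eq_integral_of_forall_compl_eq_zero (s := Ω₂)
        (f := fun y => (inner ℂ (dirac p κ v y) (u y) : ℂ)) fun y hy => by
          rw [image_eq_zero_of_notMem_tsupport fun h' => hy (hu.tsupport_subset h'),
            inner_zero_right]]
      refine integral_congr_ae ?_
      filter_upwards [h1] with y hy
      rw [hy]
    rw [mem_ofPred_eq, inner_toLp, inner_toLp, e1, e2, integral_inner_dirac p hp κ hv hu]
  rw [← inner_toLp f.2 hv.memLp, key f hf, h0, inner_zero_right]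

theorem minimalDirac_graph (p : Params) (hp : p.Admissible) (κ : ℝ) :
    (minimalDirac p κ).graph = minimalGraph p κ :=
  Submodule.toLinearPMap_graph_eq _ fun f hf h0 =>
    closure_minimalGraph_single p hp κ f (Submodule.le_topologicalClosure _ hf) h0

theorem isClosable_minimalDirac (p : Params) (hp : p.Admissible) (κ : ℝ) :
    (minimalDirac p κ).IsClosable := by
  refine ⟨(minimalGraph p κ).topologicalClosure.toLinearPMap, ?_⟩
  rw [minimalDirac_graph p hp, Submodule.toLinearPMap_graph_eq _
    (closure_minimalGraph_single p hp κ)]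

/-- `(Ψ, H^{(κ)} Ψ)` are exactly the limits in `L² × L²` of pairs `(u, 𝔥 u)`,
`u ∈ C₀^∞(Ω₂)⁴`. -/
theorem diracOp_graph (p : Params) (hp : p.Admissible) (κ : ℝ) :
    (diracOp p κ).graph = (minimalGraph p κ).topologicalClosure := by
  rw [diracOp, ← (isClosable_minimalDirac p hp κ).graph_closure_eq_closure_graph,
    minimalDirac_graph p hp]

/-- Every test function belongs to the domain of the minimal operator. -/
theorem IsTest.mem_minimalGraph (p : Params) (hp : p.Admissible) (κ : ℝ)
    {u : ℝ × ℝ → Spinor} (hu : IsTest u) :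
    (hu.memLp.toLp u, (memLp_dirac p hp κ hu).toLp _) ∈ minimalGraph p κ :=
  ⟨u, hu, hu.memLp.coeFn_toLp, (memLp_dirac p hp κ hu).coeFn_toLp⟩

end KerrNewman

end

/-! The Rellich property is a local compactness statement in `x`, and the graph norm of the Dirac
operator supplies the regularity behind it. Write `w` for `weight p` and `A` for `angular κ`, so
that the first order part of the operator is `-(σ₃ i∂ₓ + w A)` up to block signs. Its squared length
is `‖∂ₓu‖² + w²‖A u‖²` plus a cross term. Since `σ₃` anticommutes with `σ₁` and `σ₂`, the cross term
is a total derivative up to a term containing `w'` but no derivative of `u` beyond `A u`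
(`integral_re_inner_rotated`). On a compact range of `x` the weight is bounded away from zero and
`w'/w` and the potential are bounded, so `∂ₓu` and `A u` are controlled separately in `L²`
(`exists_integral_fderiv_add_angular_le`).

What remains is the singularity of `κ / sin θ` at the poles. Up to a unitary factor, `A` is `∂_θ +
(κ / sin θ) diag(σ₃, σ₃)`, which is diagonal. In each component the singular term has a fixed sign,
so integrating the derivative of the squared modulus from the appropriate end bounds the supremum
over `θ` by `∫ (‖u‖² + ‖A u‖²) dθ` (`norm_sq_le_integral_angular`). Hence thin strips along the axis
carry little mass. Away from the axis `u` is comparable to `sin θ • u`, whose two partial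
derivatives are both in `L²`, because the factor `sin θ` cancels the singularity.

The Poincaré inequality on a fine grid then bounds the `L²` norm by finitely many averages over
squares plus `ε` times the squared graph norm (`exists_integral_norm_sq_le_averages`). A cutoff in
`x` carries this over to arbitrary test functions on `Ω_{2,R}`. For a sequence bounded in the graph
norm all averages stay in a fixed ball of `ℂ⁴`, so one subsequence makes every one of them converge
and is therefore Cauchy on `Ω_{2,R}` (`exists_subseq_cauchy`). Elements of the domain of the closure
are approximated by test functions in the graph norm, and `𝒮` lies between two positive multiples of
the identity, which gives the theorem. -/

namespace KerrNewman

/-! ### Poincaré inequality on squares and on grids -/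

section Poincare

variable {E : Type*} [NormedAddCommGroup E] [NormedSpace ℝ E]

/-- The Cauchy–Schwarz inequality against the constant function `1`. -/
theorem sq_integral_le {α : Type*} [MeasurableSpace α] {μ : Measure α} [IsFiniteMeasure μ]
    {f : α → ℝ} (hf : Integrable f μ) (hf2 : Integrable (fun x => f x ^ 2) μ)
    {V : ℝ} (hV : 0 < V) (hμ : μ.real univ = V) :
    (∫ x, f x ∂μ) ^ 2 ≤ V * ∫ x, f x ^ 2 ∂μ := by
  set m := (∫ x, f x ∂μ) with hm
  -- Nonnegativity of the variance about the mean `m / V`; multiplied by `V` it is the claim.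
  have h0 : 0 ≤ ∫ x, (f x - m / V) ^ 2 ∂μ := integral_nonneg fun x => sq_nonneg _
  have h1 : ∫ x, (f x - m / V) ^ 2 ∂μ = (∫ x, f x ^ 2 ∂μ) - 2 * (m / V) * m + V * (m / V) ^ 2 := by
    have : ∀ x, (f x - m / V) ^ 2 = f x ^ 2 - 2 * (m / V) * f x + (m / V) ^ 2 := fun x => by ring
    simp_rw [this]
    have hf3 : Integrable (fun x => f x ^ 2 - 2 * (m / V) * f x) μ := hf2.sub (hf.const_mul _)
    rw [integral_add hf3 (integrable_const _), integral_sub hf2 (hf.const_mul _),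
      integral_const_mul, integral_const, hμ, smul_eq_mul]
  rw [h1] at h0
  have h2 : V * ((∫ x, f x ^ 2 ∂μ) - 2 * (m / V) * m + V * (m / V) ^ 2)
      = V * (∫ x, f x ^ 2 ∂μ) - m ^ 2 := by
    field_simp
    ring
  nlinarith [mul_nonneg hV.le h0]

/-- On an interval, a function oscillates by at most the `L¹` norm of its derivative. -/
theorem norm_sub_le_integral_norm_deriv [CompleteSpace E] {f f' : ℝ → E}
    (hf : ∀ t, HasDerivAt f (f' t) t)
    (hf' : Continuous f') {a b s t : ℝ} (hs : s ∈ Ioc a b) (ht : t ∈ Ioc a b) :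
    ‖f s - f t‖ ≤ ∫ r in Ioc a b, ‖f' r‖ := by
  rw [← intervalIntegral.integral_eq_sub_of_hasDerivAt (fun r _ => hf r)
    (hf'.intervalIntegrable _ _)]
  refine (intervalIntegral.norm_integral_le_integral_norm_uIoc).trans ?_
  refine setIntegral_mono_set (hf'.norm.integrableOn_Icc.mono_set Ioc_subset_Icc_self)
    (Eventually.of_forall fun _ => norm_nonneg _) (Eventually.of_forall fun r hr => ?_)
  change r ∈ uIoc t s at hr
  change r ∈ Ioc a b
  rw [mem_uIoc] at hr
  rcases hr with h | h
  · exact ⟨ht.1.trans h.1, h.2.trans hs.2⟩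
  · exact ⟨hs.1.trans h.1, h.2.trans ht.2⟩

/-- A half-open square of side `h`. -/
def cell (α β h : ℝ) : Set (ℝ × ℝ) := Ioc α (α + h) ×ˢ Ioc β (β + h)

theorem measurableSet_cell (α β h : ℝ) : MeasurableSet (cell α β h) :=
  measurableSet_Ioc.prod measurableSet_Ioc

theorem _root_.Continuous.integrableOn_cell {X : Type*} [NormedAddCommGroup X]
    {F : ℝ × ℝ → X} (hF : Continuous F) (α β h : ℝ) :
    IntegrableOn F (cell α β h) :=
  (hF.continuousOn.integrableOn_compact (isCompact_Icc.prod isCompact_Icc)).mono_set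
    (Set.prod_mono (Ioc_subset_Icc_self (a := α) (b := α + h)) Ioc_subset_Icc_self)

theorem volume_real_cell (α β : ℝ) {h : ℝ} (hh : 0 < h) :
    volume.real (cell α β h) = h ^ 2 := by
  simp [Measure.real, cell, Measure.volume_eq_prod, Measure.prod_prod, hh.le, sq]

instance isFiniteMeasure_restrict_cell (α β h : ℝ) :
    IsFiniteMeasure ((volume : Measure (ℝ × ℝ)).restrict (cell α β h)) :=
  ⟨by
    rw [Measure.restrict_apply_univ]
    exact (measure_mono (Set.prod_mono Ioc_subset_Icc_self Ioc_subset_Icc_self)).trans_lt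
      (isCompact_Icc.prod isCompact_Icc).measure_lt_top⟩

theorem setIntegral_cell {F : ℝ × ℝ → E} (hF : Continuous F) (α β h : ℝ) :
    ∫ y in cell α β h, F y = ∫ x in Ioc α (α + h), ∫ θ in Ioc β (β + h), F (x, θ) :=
  setIntegral_prod _ (hF.integrableOn_cell α β h)

variable [CompleteSpace E] {G Gx Gθ : ℝ × ℝ → E}

/-- Go from `(x, θ)` to a point `q` of the square along the horizontal segment at height `θ` and
then along the vertical segment over `q.1`, and average over `q`. The vertical legs average to an
integral over the square. The horizontal leg does not depend on `q` and stays a line integral; it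
becomes an integral over the square only once its square is integrated in `θ`. -/
theorem norm_le_of_mem_cell (hGc : Continuous G)
    (hx : ∀ y : ℝ × ℝ, HasDerivAt (fun s => G (s, y.2)) (Gx y) y.1) (hGx : Continuous Gx)
    (hθ : ∀ y : ℝ × ℝ, HasDerivAt (fun t => G (y.1, t)) (Gθ y) y.2) (hGθ : Continuous Gθ)
    {α β h : ℝ} (hh : 0 < h) {x θ : ℝ} (hxm : x ∈ Ioc α (α + h)) (hθm : θ ∈ Ioc β (β + h)) :
    ‖G (x, θ)‖ ≤ (h ^ 2)⁻¹ * ‖∫ y in cell α β h, G y‖ + (∫ s in Ioc α (α + h), ‖Gx (s, θ)‖)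
      + h⁻¹ * ∫ y in cell α β h, ‖Gθ y‖ := by
  set a := ∫ s in Ioc α (α + h), ‖Gx (s, θ)‖
  have hosc : ∀ q ∈ cell α β h, ‖G (x, θ) - G q‖ ≤ a + ∫ t in Ioc β (β + h), ‖Gθ (q.1, t)‖ := by
    intro q hq
    have h1 := norm_sub_le_integral_norm_deriv (f := fun s => G (s, θ)) (f' := fun s => Gx (s, θ))
      (fun t => hx (t, θ)) (by fun_prop) hxm hq.1
    have h2 := norm_sub_le_integral_norm_deriv (f := fun t => G (q.1, t))
      (f' := fun t => Gθ (q.1, t)) (fun t => hθ (q.1, t)) (by fun_prop) hθm hq.2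
    calc ‖G (x, θ) - G q‖ = ‖(G (x, θ) - G (q.1, θ)) + (G (q.1, θ) - G (q.1, q.2))‖ := by simp
      _ ≤ _ := (norm_add_le _ _).trans (add_le_add h1 h2)
  have hV := volume_real_cell α β hh
  have hB : Continuous fun s => ∫ t in Ioc β (β + h), ‖Gθ (s, t)‖ := by
    simp_rw [← intervalIntegral.integral_of_le (show β ≤ β + h by linarith)]
    exact intervalIntegral.continuous_parametric_intervalIntegral_of_continuous' (by fun_prop) _ _
  have h3 : ‖∫ q in cell α β h, (G (x, θ) - G q)‖
      ≤ h ^ 2 * a + h * ∫ y in cell α β h, ‖Gθ y‖ := by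
    calc _ ≤ ∫ q in cell α β h, (a + ∫ t in Ioc β (β + h), ‖Gθ (q.1, t)‖) := by
          refine (norm_integral_le_integral_norm _).trans
            (setIntegral_mono_on ?_ ?_ (measurableSet_cell _ _ _) hosc)
          · exact Continuous.integrableOn_cell (by fun_prop) _ _ _
          · exact (continuous_const.add (hB.comp continuous_fst)).integrableOn_cell _ _ _
      _ = _ := by
        have hB' : Continuous fun q : ℝ × ℝ => ∫ t in Ioc β (β + h), ‖Gθ (q.1, t)‖ :=
          hB.comp continuous_fst
        rw [integral_add (integrable_const _) (hB'.integrableOn_cell _ _ _), setIntegral_const, hV,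
          smul_eq_mul, setIntegral_cell (F := fun q => ∫ t in Ioc β (β + h), ‖Gθ (q.1, t)‖)
            hB', setIntegral_cell (F := fun y => ‖Gθ y‖) hGθ.norm]
        simp [integral_const_mul, hh.le]
  rw [integral_sub (integrable_const _) (hGc.integrableOn_cell _ _ _), setIntegral_const, hV] at h3
  have hh2 : 0 < h ^ 2 := by positivity
  have h4 : h ^ 2 * ‖G (x, θ)‖ ≤ ‖∫ y in cell α β h, G y‖
      + (h ^ 2 * a + h * ∫ y in cell α β h, ‖Gθ y‖) := by
    calc h ^ 2 * ‖G (x, θ)‖ = ‖h ^ 2 • G (x, θ)‖ := by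
          rw [norm_smul, Real.norm_of_nonneg hh2.le]
      _ ≤ _ := by
        have := norm_add_le (∫ y in cell α β h, G y) (h ^ 2 • G (x, θ) - ∫ y in cell α β h, G y)
        rw [add_sub_cancel] at this
        linarith
  rw [← mul_le_mul_iff_of_pos_left hh2]
  refine h4.trans (le_of_eq ?_)
  field_simp
  ring

/-- The Poincaré inequality on a square. -/
theorem integral_cell_norm_sq_le (hGc : Continuous G)
    (hx : ∀ y : ℝ × ℝ, HasDerivAt (fun s => G (s, y.2)) (Gx y) y.1) (hGx : Continuous Gx)
    (hθ : ∀ y : ℝ × ℝ, HasDerivAt (fun t => G (y.1, t)) (Gθ y) y.2) (hGθ : Continuous Gθ)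
    (α β : ℝ) {h : ℝ} (hh : 0 < h) :
    ∫ y in cell α β h, ‖G y‖ ^ 2 ≤ 3 * (h ^ 2)⁻¹ * ‖∫ y in cell α β h, G y‖ ^ 2
      + 3 * h ^ 2 * ((∫ y in cell α β h, ‖Gx y‖ ^ 2) + ∫ y in cell α β h, ‖Gθ y‖ ^ 2) := by
  set A := ‖∫ y in cell α β h, G y‖
  set Dθ := ∫ y in cell α β h, ‖Gθ y‖ ^ 2
  have hV := volume_real_cell α β hh
  have hh2 : 0 < h ^ 2 := by positivity
  have hC : (∫ y in cell α β h, ‖Gθ y‖) ^ 2 ≤ h ^ 2 * Dθ :=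
    sq_integral_le (Continuous.integrableOn_cell (by fun_prop) _ _ _)
      (Continuous.integrableOn_cell (by fun_prop) _ _ _) hh2
      (by rw [measureReal_restrict_apply_univ, hV])
  have hI : Continuous fun θ => ∫ s in Ioc α (α + h), ‖Gx (s, θ)‖ ^ 2 := by
    simp_rw [← intervalIntegral.integral_of_le (show α ≤ α + h by linarith)]
    exact intervalIntegral.continuous_parametric_intervalIntegral_of_continuous' (by fun_prop) _ _
  -- The factor 3 comes from `(X + Y + Z)² ≤ 3 (X² + Y² + Z²)`. Cauchy–Schwarz on an interval of
  -- length `h` and on a square of area `h ^ 2` turns the two `L¹` norms into `L²` norms.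
  have hpt : ∀ y ∈ cell α β h, ‖G y‖ ^ 2 ≤ 3 * ((h ^ 2)⁻¹ * A) ^ 2 + 3 * Dθ
      + 3 * h * ∫ s in Ioc α (α + h), ‖Gx (s, y.2)‖ ^ 2 := by
    rintro ⟨x, θ⟩ hy
    have h1 := norm_le_of_mem_cell hGc hx hGx hθ hGθ hh hy.1 hy.2
    have h2 : (∫ s in Ioc α (α + h), ‖Gx (s, θ)‖) ^ 2
        ≤ h * ∫ s in Ioc α (α + h), ‖Gx (s, θ)‖ ^ 2 :=
      sq_integral_le (Continuous.integrableOn_Ioc (by fun_prop))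
        (Continuous.integrableOn_Ioc (by fun_prop)) hh
        (by simp [hh.le])
    have h3 : (h⁻¹ * ∫ y in cell α β h, ‖Gθ y‖) ^ 2 ≤ Dθ := by
      rw [mul_pow, inv_pow, inv_mul_le_iff₀ hh2]
      exact hC
    set X := (h ^ 2)⁻¹ * A
    set Y := ∫ s in Ioc α (α + h), ‖Gx (s, θ)‖
    set Z := h⁻¹ * ∫ y in cell α β h, ‖Gθ y‖
    have h4 : ‖G (x, θ)‖ ^ 2 ≤ (X + Y + Z) ^ 2 := pow_le_pow_left₀ (norm_nonneg _) h1 2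
    have h5 : (X + Y + Z) ^ 2 ≤ 3 * X ^ 2 + 3 * Y ^ 2 + 3 * Z ^ 2 := by
      nlinarith [sq_nonneg (X - Y), sq_nonneg (X - Z), sq_nonneg (Y - Z)]
    dsimp only
    linarith
  have hcont : Continuous fun y : ℝ × ℝ => 3 * h * ∫ s in Ioc α (α + h), ‖Gx (s, y.2)‖ ^ 2 :=
    continuous_const.mul (hI.comp continuous_snd)
  refine (setIntegral_mono_on (Continuous.integrableOn_cell (by fun_prop) _ _ _)
    (Continuous.integrableOn_cell (by fun_prop) _ _ _) (measurableSet_cell _ _ _) hpt).trans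
      (le_of_eq ?_)
  rw [integral_add (integrable_const _) (hcont.integrableOn_cell _ _ _), setIntegral_const, hV,
    integral_const_mul]
  -- The integrand is independent of `y.1`, so that integration contributes only the factor `h`; the
  -- order of the other two is then exchanged.
  have hswap : ∫ y in cell α β h, ∫ s in Ioc α (α + h), ‖Gx (s, y.2)‖ ^ 2
      = h * ∫ y in cell α β h, ‖Gx y‖ ^ 2 := by
    rw [setIntegral_cell (F := fun y => ∫ s in Ioc α (α + h), ‖Gx (s, y.2)‖ ^ 2)
      (hI.comp continuous_snd)]
    dsimp only
    rw [setIntegral_const, smul_eq_mul, Real.volume_real_Ioc_of_le (by linarith),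
      add_sub_cancel_left, cell, Measure.volume_eq_prod, ← setIntegral_prod_swap,
      setIntegral_prod]
    · rfl
    · exact (Continuous.integrableOn_cell (F := fun y => ‖Gx y.swap‖ ^ 2) (by fun_prop) β α h)
  rw [hswap]
  simp only [smul_eq_mul]
  field_simp
  ring

/-- The squares of the grid of mesh `1 / (N + 1)`. -/
def gridCell (i : ℕ × ℤ × ℤ) : Set (ℝ × ℝ) :=
  cell (i.2.1 * ((i.1 : ℝ) + 1)⁻¹) (i.2.2 * ((i.1 : ℝ) + 1)⁻¹) ((i.1 : ℝ) + 1)⁻¹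

/-- Because the squares are open on the left and closed on the right, the index is a ceiling minus
one. Covering and disjointness of the grid thereby reduce to integer arithmetic. -/
theorem mem_gridCell {N : ℕ} {j k : ℤ} {y : ℝ × ℝ} :
    y ∈ gridCell (N, j, k) ↔ ⌈y.1 * (N + 1)⌉ = j + 1 ∧ ⌈y.2 * (N + 1)⌉ = k + 1 := by
  have hN : (0 : ℝ) < N + 1 := by positivity
  have aux : ∀ (t : ℝ) (m : ℤ), t ∈ Ioc (m * ((N : ℝ) + 1)⁻¹) (m * ((N : ℝ) + 1)⁻¹ + ((N : ℝ) + 1)⁻¹)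
      ↔ ⌈t * (N + 1)⌉ = m + 1 := by
    intro t m
    rw [Int.ceil_eq_iff, mem_Ioc, ← div_eq_mul_inv, div_lt_iff₀ hN,
      show (m : ℝ) / ((N : ℝ) + 1) + ((N : ℝ) + 1)⁻¹ = (m + 1) / ((N : ℝ) + 1) by field_simp,
      le_div_iff₀ hN]
    push_cast
    rw [add_sub_cancel_right]
  rw [← aux, ← aux]
  rfl

/-- A function supported in a fixed bounded set is controlled in `L²` by finitely many averages,
up to a small multiple of its gradient. -/
theorem integral_norm_sq_le_grid (N : ℕ) {K : Set (ℝ × ℝ)} (hK : Bornology.IsBounded K) :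
    ∃ s : Finset (ℕ × ℤ × ℤ), ∀ G Gx Gθ : ℝ × ℝ → E, Continuous G →
    (∀ y : ℝ × ℝ, HasDerivAt (fun s => G (s, y.2)) (Gx y) y.1) → Continuous Gx →
    (∀ y : ℝ × ℝ, HasDerivAt (fun t => G (y.1, t)) (Gθ y) y.2) → Continuous Gθ →
    Integrable (fun y => ‖Gx y‖ ^ 2) → Integrable (fun y => ‖Gθ y‖ ^ 2) →
    (∀ y, y ∉ K → G y = 0) →
    ∫ y, ‖G y‖ ^ 2 ≤ 3 * ((N : ℝ) + 1) ^ 2 * ∑ i ∈ s, ‖∫ y in gridCell i, G y‖ ^ 2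
      + 3 * (((N : ℝ) + 1) ^ 2)⁻¹ * ((∫ y, ‖Gx y‖ ^ 2) + ∫ y, ‖Gθ y‖ ^ 2) := by
  obtain ⟨r, hr⟩ := hK.subset_closedBall 0
  -- The absolute value keeps the bound meaningful when the radius `r` is negative. The range of
  -- indices starts at `-m - 1` because an index is a ceiling minus one. The set `s` depends on `N`
  -- and `K` only, not on the function.
  set m : ℤ := ⌈|r| * (N + 1)⌉ + 1 with hm
  set s : Finset (ℕ × ℤ × ℤ) := {N} ×ˢ Finset.Icc (-m - 1) m ×ˢ Finset.Icc (-m - 1) m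
  refine ⟨s, fun G Gx Gθ hGc hx hGx hθ hGθ hix hiθ hG0 => ?_⟩
  have hN : (0 : ℝ) < N + 1 := by positivity
  have hcover : K ⊆ ⋃ i ∈ s, gridCell i := by
    intro y hy
    have hy' := hr hy
    rw [mem_closedBall_zero_iff, Prod.norm_def, max_le_iff, Real.norm_eq_abs, Real.norm_eq_abs]
      at hy'
    have aux : ∀ t : ℝ, |t| ≤ r → ⌈t * (N + 1)⌉ - 1 ∈ Finset.Icc (-m - 1) m := by
      intro t ht
      have ht' := abs_le.1 (ht.trans (le_abs_self r))
      have hcm := Int.le_ceil (|r| * ((N : ℝ) + 1))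
      rw [Finset.mem_Icc]
      constructor
      · have : (-m : ℤ) ≤ ⌈t * (N + 1)⌉ := by
          have h1 : (-m : ℤ) < ⌈t * (N + 1)⌉ := by
            rw [Int.lt_ceil, hm]
            push_cast
            nlinarith
          exact h1.le
        linarith
      · have : ⌈t * ((N : ℝ) + 1)⌉ ≤ ⌈|r| * ((N : ℝ) + 1)⌉ :=
          Int.ceil_le_ceil (by nlinarith)
        linarith
    refine mem_biUnion (x := (N, ⌈y.1 * (N + 1)⌉ - 1, ⌈y.2 * (N + 1)⌉ - 1)) ?_ ?_
    · simp only [s, Finset.coe_product, Set.mem_prod, Finset.mem_coe, Finset.mem_singleton]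
      exact ⟨trivial, aux _ hy'.1, aux _ hy'.2⟩
    · rw [mem_gridCell]
      simp
  have hdisj : (s : Set (ℕ × ℤ × ℤ)).PairwiseDisjoint gridCell := by
    rintro ⟨N₁, j, k⟩ h1 ⟨N₂, j', k'⟩ h2 hne
    simp only [s, Finset.coe_product, Set.mem_prod, Finset.mem_coe, Finset.mem_singleton] at h1 h2
    obtain ⟨rfl, -⟩ := h1
    obtain ⟨rfl, -⟩ := h2
    refine Set.disjoint_left.2 fun y hy1 hy2 => hne ?_
    rw [mem_gridCell] at hy1 hy2
    simp only [Prod.mk.injEq, true_and]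
    omega
  have hmeas : ∀ i ∈ s, MeasurableSet (gridCell i) := fun i _ => measurableSet_cell _ _ _
  have hsum : ∀ F : ℝ × ℝ → E, Continuous F → ∫ y in ⋃ i ∈ s, gridCell i, ‖F y‖ ^ 2
      = ∑ i ∈ s, ∫ y in gridCell i, ‖F y‖ ^ 2 := fun F hF =>
    integral_biUnion_finset s hmeas hdisj fun i _ =>
      Continuous.integrableOn_cell (by fun_prop) _ _ _
  have hle : ∀ F : ℝ × ℝ → E, Continuous F → Integrable (fun y => ‖F y‖ ^ 2) →
      ∑ i ∈ s, ∫ y in gridCell i, ‖F y‖ ^ 2 ≤ ∫ y, ‖F y‖ ^ 2 := by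
    intro F hF hi
    rw [← hsum F hF]
    exact setIntegral_le_integral hi (Eventually.of_forall fun y => by positivity)
  have hGeq : ∫ y, ‖G y‖ ^ 2 = ∑ i ∈ s, ∫ y in gridCell i, ‖G y‖ ^ 2 := by
    rw [← hsum G hGc]
    refine (setIntegral_eq_integral_of_forall_compl_eq_zero fun y hy => ?_).symm
    rw [hG0 y fun h => hy (hcover h)]
    simp
  rw [hGeq]
  calc _ ≤ ∑ i ∈ s, (3 * ((N : ℝ) + 1) ^ 2 * ‖∫ y in gridCell i, G y‖ ^ 2
        + 3 * (((N : ℝ) + 1) ^ 2)⁻¹ * ((∫ y in gridCell i, ‖Gx y‖ ^ 2)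
          + ∫ y in gridCell i, ‖Gθ y‖ ^ 2)) := by
        refine Finset.sum_le_sum fun i hi => ?_
        obtain ⟨N', j, k⟩ := i
        simp only [s, Finset.mem_product, Finset.mem_singleton] at hi
        obtain ⟨rfl, -⟩ := hi
        have := integral_cell_norm_sq_le hGc hx hGx hθ hGθ (j * ((N' : ℝ) + 1)⁻¹)
          (k * ((N' : ℝ) + 1)⁻¹) (inv_pos.2 hN)
        rw [inv_pow, inv_inv] at this
        exact this
    -- The squares are disjoint, so the gradient integrals over them add up to at most the integrals
    -- over the plane.
    _ ≤ _ := by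
      rw [Finset.sum_add_distrib, ← Finset.mul_sum, ← Finset.mul_sum, Finset.sum_add_distrib]
      have := hle Gx hGx hix
      have := hle Gθ hGθ hiθ
      gcongr

end Poincare

/-! ### Pauli algebra and the square of the first order part -/

theorem act_act (A B : Mat4) (v : Spinor) : act A (act B v) = act (A * B) v := by
  simp [act]

theorem act_one (v : Spinor) : act 1 v = v := by
  simp [act]

theorem act_neg_mat (A : Mat4) (v : Spinor) : act (-A) v = -act A v := by
  simp [act]

theorem pm_mul (A B : Matrix (Fin 2) (Fin 2) ℂ) :
    pm A * pm B = Matrix.fromBlocks (A * B) 0 0 (A * B) := by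
  simp [pm, Matrix.fromBlocks_multiply]

theorem σ₁_mul_σ₁ : σ₁ * σ₁ = 1 := by
  ext i j; fin_cases i <;> fin_cases j <;> simp [σ₁]

theorem σ₂_mul_σ₂ : σ₂ * σ₂ = 1 := by
  ext i j; fin_cases i <;> fin_cases j <;> simp [σ₂]

theorem σ₃_mul_σ₃ : σ₃ * σ₃ = 1 := by
  ext i j; fin_cases i <;> fin_cases j <;> simp [σ₃]

theorem σ₃_mul_σ₁ : σ₃ * σ₁ = -(σ₁ * σ₃) := by
  ext i j; fin_cases i <;> fin_cases j <;> simp [σ₁, σ₃]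

theorem σ₃_mul_σ₂ : σ₃ * σ₂ = -(σ₂ * σ₃) := by
  ext i j; fin_cases i <;> fin_cases j <;> simp [σ₂, σ₃]

theorem pm_mul_self {A : Matrix (Fin 2) (Fin 2) ℂ} (hA : A * A = 1) : pm A * pm A = 1 := by
  rw [pm_mul, hA, Matrix.fromBlocks_one]

theorem pm_anticomm {A B : Matrix (Fin 2) (Fin 2) ℂ} (h : A * B = -(B * A)) :
    pm A * pm B = -(pm B * pm A) := by
  rw [pm_mul, pm_mul, h, Matrix.fromBlocks_neg, neg_zero]

/-- A Hermitian involution is unitary. -/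
theorem norm_act_pm {A : Matrix (Fin 2) (Fin 2) ℂ} (hA : A.conjTranspose = A) (h1 : A * A = 1)
    (v : Spinor) : ‖act (pm A) v‖ = ‖v‖ := by
  have h : (inner ℂ (act (pm A) v) (act (pm A) v) : ℂ) = inner ℂ v v := by
    rw [inner_act, act_act, pm_conjTranspose hA, pm_mul_self h1, act_one]
  rw [inner_self_eq_norm_sq_to_K, inner_self_eq_norm_sq_to_K] at h
  norm_cast at h
  exact (sq_eq_sq₀ (norm_nonneg _) (norm_nonneg _)).1 h

/-- The angular part `σ₁ i∂_θ + σ₂ κ / sin θ` of the Dirac operator. -/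
noncomputable def angular (κ : ℝ) (u : ℝ × ℝ → Spinor) (y : ℝ × ℝ) : Spinor :=
  act (pm σ₁) (Complex.I • fderiv ℝ u y (0, 1)) + ((κ / sin y.2 : ℝ) : ℂ) • act (pm σ₂) (u y)

theorem dirac₁_eq (p : Params) (κ : ℝ) (u : ℝ × ℝ → Spinor) (y : ℝ × ℝ) :
    dirac₁ p κ u y = -(act (pm σ₃) (Complex.I • fderiv ℝ u y (1, 0))
      + (weight p y.1 : ℂ) • angular κ u y) := by
  unfold dirac₁ angular
  abel

/-- The vector `-i σ₃ A u`, where `A` is the angular operator. -/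
noncomputable def rotated (κ : ℝ) (u : ℝ × ℝ → Spinor) (y : ℝ × ℝ) : Spinor :=
  -Complex.I • act (pm σ₃) (angular κ u y)

theorem norm_rotated (κ : ℝ) (u : ℝ × ℝ → Spinor) (y : ℝ × ℝ) :
    ‖rotated κ u y‖ = ‖angular κ u y‖ := by
  rw [rotated, norm_smul, norm_act_pm σ₃_conjTranspose σ₃_mul_σ₃]
  simp

/-- This form separates the skew-Hermitian coefficient of `∂_θ` from the Hermitian coefficient of `κ
/ sin θ`; these two symmetries drive the integration by parts of the cross term. -/
theorem rotated_eq (κ : ℝ) (u : ℝ × ℝ → Spinor) (y : ℝ × ℝ) :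
    rotated κ u y = act (pm σ₃ * pm σ₁) (fderiv ℝ u y (0, 1))
      + ((κ / sin y.2 : ℝ) : ℂ) • act (-Complex.I • (pm σ₃ * pm σ₂)) (u y) := by
  simp only [rotated, angular, act_add, act_smul, act_act, smul_add, smul_smul, act_smul_mat]
  congr 2
  · simp
  · ring

/-- Both `σ₃` and the scalar `i` are moved to the right-hand argument of the cross term, where they
produce `rotated`; `pm σ₃` disappears from the norm of `∂ₓu` because it is an isometry. -/
theorem norm_dirac₁_sq (p : Params) (κ : ℝ) (u : ℝ × ℝ → Spinor) (y : ℝ × ℝ) :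
    ‖dirac₁ p κ u y‖ ^ 2 = ‖fderiv ℝ u y (1, 0)‖ ^ 2 + weight p y.1 ^ 2 * ‖angular κ u y‖ ^ 2
      + 2 * weight p y.1 * (inner ℂ (fderiv ℝ u y (1, 0)) (rotated κ u y) : ℂ).re := by
  have h : (inner ℂ (act (pm σ₃) (Complex.I • fderiv ℝ u y (1, 0)))
      ((weight p y.1 : ℂ) • angular κ u y) : ℂ)
      = (weight p y.1 : ℂ) * inner ℂ (fderiv ℝ u y (1, 0)) (rotated κ u y) := by
    rw [rotated, inner_act, pm_conjTranspose σ₃_conjTranspose]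
    simp only [inner_smul_left, inner_smul_right, act_smul, Complex.conj_I]
  rw [dirac₁_eq, norm_neg, norm_add_sq (𝕜 := ℂ), h, norm_act_pm σ₃_conjTranspose σ₃_mul_σ₃,
    norm_smul, norm_smul]
  simp [mul_pow]
  ring

/-! ### Calculus of test functions -/

theorem IsTest.fderiv_apply {u : ℝ × ℝ → Spinor} (hu : IsTest u) (d : ℝ × ℝ) :
    IsTest fun y => fderiv ℝ u y d where
  contDiff := (hu.contDiff.fderiv_right (m := ∞) (by simp)).clm_apply contDiff_const
  hasCompactSupport := hu.hasCompactSupport.fderiv_apply (𝕜 := ℝ) d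
  tsupport_subset := (tsupport_fderiv_apply_subset ℝ d).trans hu.tsupport_subset

theorem IsTest.fderiv_comm {u : ℝ × ℝ → Spinor} (hu : IsTest u) (d d' y : ℝ × ℝ) :
    fderiv ℝ (fun y => fderiv ℝ u y d) y d' = fderiv ℝ (fun y => fderiv ℝ u y d') y d := by
  have hd : DifferentiableAt ℝ (fderiv ℝ u) y :=
    ((hu.contDiff.fderiv_right (m := ∞) (by simp)).differentiable (by simp)) y
  rw [fderiv_clm_apply hd (by fun_prop), fderiv_clm_apply hd (by fun_prop)]
  have := (hu.contDiff.contDiffAt (x := y)).isSymmSndFDerivAt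
    (by simpa using WithTop.coe_le_coe.2 (le_top (a := (2 : ℕ∞)))) d d'
  simpa using this.symm

theorem IsTest.eq_zero {u : ℝ × ℝ → Spinor} {y : ℝ × ℝ} (hy : y ∉ tsupport u) : u y = 0 :=
  image_eq_zero_of_notMem_tsupport hy

theorem fderiv_eq_zero {u : ℝ × ℝ → Spinor} {y : ℝ × ℝ} (hy : y ∉ tsupport u) :
    fderiv ℝ u y = 0 := by
  by_contra h
  exact hy (support_fderiv_subset ℝ (f := u) h)

theorem tsupport_subset_of_eq_zero {X Y Z : Type*} [TopologicalSpace X] [Zero Y] [Zero Z]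
    {f : X → Y} {u : X → Z} (h : ∀ y, y ∉ tsupport u → f y = 0) : tsupport f ⊆ tsupport u :=
  closure_minimal (fun _ hy => by_contra fun hn => hy (h _ hn)) (isClosed_tsupport u)

theorem angular_eq_zero (κ : ℝ) {u : ℝ × ℝ → Spinor} {y : ℝ × ℝ} (hy : y ∉ tsupport u) :
    angular κ u y = 0 := by
  simp [angular, IsTest.eq_zero hy, fderiv_eq_zero hy, act_zero]

theorem continuous_angular (κ : ℝ) {u : ℝ × ℝ → Spinor} (hu : IsTest u) :
    Continuous (angular κ u) := by
  have hd : Continuous (fderiv ℝ u) := hu.contDiff.continuous_fderiv (by simp)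
  have huc := hu.contDiff.continuous
  have ha := continuous_act
  refine ContinuousOn.continuous_of_tsupport_subset ?_ isOpen_Ω₂ ((tsupport_subset_of_eq_zero
    fun y hy => angular_eq_zero κ hy).trans hu.tsupport_subset)
  have hsin : ContinuousOn (fun y : ℝ × ℝ => ((κ / sin y.2 : ℝ) : ℂ)) Ω₂ :=
    Complex.continuous_ofReal.comp_continuousOn (ContinuousOn.div (by fun_prop) (by fun_prop)
      fun y hy => (sin_pos_of_mem_Ioo hy.2).ne')
  have h1 : Continuous fun y => act (pm σ₁) (Complex.I • fderiv ℝ u y (0, 1)) := by fun_prop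
  exact h1.continuousOn.add (hsin.smul ((ha _).comp huc).continuousOn)

/-! ### Integration by parts and the elliptic estimate on compact ranges of `x` -/

/-- The square root causes no loss of smoothness, since `Δ` is strictly positive at every `r(x)`:
the horizon is not attained at finite `x`. -/
theorem contDiff_weight (p : Params) (hp : p.Admissible) : ContDiff ℝ 1 (weight p) := by
  have hr0 := fun x => (radius_sq_add_pos p hp x).ne'
  have hrc := continuous_radius p hp
  have hr : ContDiff ℝ 1 (radius p) := by
    rw [contDiff_one_iff_deriv]
    refine ⟨fun x => (hasDerivAt_radius p hp x).differentiableAt, ?_⟩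
    rw [show deriv (radius p) = _ from funext fun x => (hasDerivAt_radius p hp x).deriv]
    exact ((continuous_Delta p).comp hrc).div (by fun_prop) hr0
  have hD : ContDiff ℝ 1 fun x => Delta p (radius p x) := by
    unfold Delta
    fun_prop
  have hs : ContDiff ℝ 1 fun x => √(Delta p (radius p x)) :=
    hD.sqrt fun x => (Delta_pos p hp (rPlus_lt_radius p hp x)).ne'
  exact hs.div (by fun_prop) hr0

theorem weight_pos (p : Params) (hp : p.Admissible) (x : ℝ) : 0 < weight p x :=
  div_pos (Real.sqrt_pos.2 (Delta_pos p hp (rPlus_lt_radius p hp x))) (radius_sq_add_pos p hp x)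

/-- Both terms of the first order part square to Laplacians, up to a commutator that contains only
the derivative of the weight. -/
theorem integral_re_inner_rotated (p : Params) (hp : p.Admissible) (κ : ℝ) {u : ℝ × ℝ → Spinor}
    (hu : IsTest u) :
    Integrable (fun y => deriv (weight p) y.1 * (inner ℂ (u y) (rotated κ u y) : ℂ).re
      + 2 * weight p y.1 * (inner ℂ (fderiv ℝ u y (1, 0)) (rotated κ u y) : ℂ).re) ∧
    ∫ y, (deriv (weight p) y.1 * (inner ℂ (u y) (rotated κ u y) : ℂ).re
      + 2 * weight p y.1 * (inner ℂ (fderiv ℝ u y (1, 0)) (rotated κ u y) : ℂ).re) = 0 := by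
  set B : Mat4 := pm σ₃ * pm σ₁ with hB
  set D : Mat4 := -Complex.I • (pm σ₃ * pm σ₂) with hD
  have hBt : B.conjTranspose = -B := by
    rw [hB, Matrix.conjTranspose_mul, pm_conjTranspose σ₁_conjTranspose,
      pm_conjTranspose σ₃_conjTranspose, pm_anticomm σ₃_mul_σ₁, neg_neg]
  have hDt : D.conjTranspose = D := by
    rw [hD, Matrix.conjTranspose_smul, Matrix.conjTranspose_mul, pm_conjTranspose σ₂_conjTranspose,
      pm_conjTranspose σ₃_conjTranspose, pm_anticomm σ₃_mul_σ₂]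
    simp
  set ux : ℝ × ℝ → Spinor := fun y => fderiv ℝ u y (1, 0) with hux
  set uθ : ℝ × ℝ → Spinor := fun y => fderiv ℝ u y (0, 1) with huθ
  have hx : IsTest ux := hu.fderiv_apply _
  have hθ : IsTest uθ := hu.fderiv_apply _
  have hsym : ∀ y, fderiv ℝ ux y (0, 1) = fderiv ℝ uθ y (1, 0) := fun y => hu.fderiv_comm _ _ y
  have hw := contDiff_weight p hp
  have hwc := hw.continuous
  have hw' : Continuous (deriv (weight p)) := hw.continuous_deriv le_rfl
  have hwd : ∀ x, HasDerivAt (weight p) (deriv (weight p) x) x := fun x =>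
    (hw.differentiable (by simp) x).hasDerivAt
  have ha := continuous_act
  have huc := hu.contDiff.continuous
  have hxc := hx.contDiff.continuous
  have hθc := hθ.contDiff.continuous
  have hxθc : Continuous fun y => fderiv ℝ ux y (0, 1) := (hx.fderiv_apply (0, 1)).contDiff.continuous
  have hθxc : Continuous fun y => fderiv ℝ uθ y (1, 0) := (hθ.fderiv_apply (1, 0)).contDiff.continuous
  have hcs : ∀ f : ℝ × ℝ → ℂ, Continuous f → (∀ y, y ∉ tsupport u → f y = 0) → Integrable f :=
    fun f hf h => hf.integrable_of_hasCompactSupport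
      (HasCompactSupport.intro hu.hasCompactSupport h)
  have hu0 : ∀ y, y ∉ tsupport u → u y = 0 := fun y hy => image_eq_zero_of_notMem_tsupport hy
  have hx0 : ∀ y, y ∉ tsupport u → ux y = 0 := fun y hy => by simp [hux, fderiv_eq_zero hy]
  have hθ0 : ∀ y, y ∉ tsupport u → uθ y = 0 := fun y hy => by simp [huθ, fderiv_eq_zero hy]
  -- The factor `κ / sin θ` is continuous on `Ω₂`, and the product is supported in the support of
  -- `u`, a compact subset of `Ω₂`.
  have hk : ∀ f : ℝ × ℝ → ℂ, Continuous f → (∀ y, y ∉ tsupport u → f y = 0) →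
      Continuous fun y => ((κ / sin y.2 : ℝ) : ℂ) * f y := by
    intro f hf h0
    refine ContinuousOn.continuous_of_tsupport_subset ?_ isOpen_Ω₂ ((tsupport_subset_of_eq_zero
      fun y hy => by simp [h0 y hy]).trans hu.tsupport_subset)
    have hsin : ContinuousOn (fun y : ℝ × ℝ => ((κ / sin y.2 : ℝ) : ℂ)) Ω₂ :=
      Complex.continuous_ofReal.comp_continuousOn (ContinuousOn.div (by fun_prop) (by fun_prop)
        fun y hy => (sin_pos_of_mem_Ioo hy.2).ne')
    exact hsin.mul hf.continuousOn
  have hwcc : Continuous fun y : ℝ × ℝ => (weight p y.1 : ℂ) := by fun_prop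
  have hwcc' : Continuous fun y : ℝ × ℝ => ((deriv (weight p) y.1 : ℝ) : ℂ) := by fun_prop
  have hwl : ∀ y : ℝ × ℝ, HasLineDerivAt ℝ (fun y : ℝ × ℝ => (weight p y.1 : ℂ))
      ((deriv (weight p) y.1 : ℝ) : ℂ) y (1, 0) := by
    intro y
    have h1 : HasDerivAt (fun t : ℝ => y.1 + t * 1) 1 0 := by
      simpa using (hasDerivAt_id (0 : ℝ)).const_add y.1
    have h2 : HasDerivAt (weight p) (deriv (weight p) y.1) (y.1 + 0 * 1) := by simpa using hwd y.1
    have h3 := (h2.scomp (0 : ℝ) h1).ofReal_comp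
    unfold HasLineDerivAt
    simpa using h3
  have hwmul : ∀ (f : ℝ × ℝ → ℂ) (f' : ℂ) (y : ℝ × ℝ), HasLineDerivAt ℝ f f' y (1, 0) →
      HasLineDerivAt ℝ (fun y => (weight p y.1 : ℂ) * f y)
        ((weight p y.1 : ℂ) * f' + (deriv (weight p) y.1 : ℝ) * f y) y (1, 0) := by
    intro f f' y h
    have h1 := HasDerivAt.mul (hwl y) h
    simp only [zero_smul, add_zero] at h1
    rw [add_comm] at h1
    exact h1
  -- The three functions are the total derivatives `g₁ = ∂ₓ(w⟨u, B ∂_θ u⟩)`, `g₂ = ∂_θ(w⟨u, B ∂ₓu⟩)`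
  -- and `g₃ = ∂ₓ((κ / sin θ) w⟨u, D u⟩)`. Neither `w` is differentiated in `θ` nor `1 / sin θ` at
  -- all, so `w'` is the only derivative of a coefficient that occurs.
  set g₁ : ℝ × ℝ → ℂ := fun y => (weight p y.1 : ℂ)
    * (inner ℂ (u y) (act B (fderiv ℝ uθ y (1, 0))) + inner ℂ (ux y) (act B (uθ y)))
    + ((deriv (weight p) y.1 : ℝ) : ℂ) * inner ℂ (u y) (act B (uθ y)) with hg₁
  set g₂ : ℝ × ℝ → ℂ := fun y => (weight p y.1 : ℂ)
    * (inner ℂ (u y) (act B (fderiv ℝ ux y (0, 1))) + inner ℂ (uθ y) (act B (ux y))) with hg₂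
  set g₃ : ℝ × ℝ → ℂ := fun y => ((κ / sin y.2 : ℝ) : ℂ) * ((weight p y.1 : ℂ)
    * (inner ℂ (u y) (act D (ux y)) + inner ℂ (ux y) (act D (u y)))
    + ((deriv (weight p) y.1 : ℝ) : ℂ) * inner ℂ (u y) (act D (u y))) with hg₃
  have i₁ : Integrable g₁ := hcs _ (by fun_prop) fun y hy => by simp [hg₁, hu0 y hy, hx0 y hy]
  have i₂ : Integrable g₂ := hcs _ (by fun_prop) fun y hy => by simp [hg₂, hu0 y hy, hθ0 y hy]
  have i₃ : Integrable g₃ := hcs _ (hk _ (by fun_prop) fun y hy => by simp [hu0 y hy, hx0 y hy])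
    fun y hy => by simp [hg₃, hu0 y hy, hx0 y hy]
  have z₁ : ∫ y, g₁ y = 0 := by
    refine integral_lineDeriv_eq_zero (v := (1, 0))
      (g := fun y => (weight p y.1 : ℂ) * inner ℂ (u y) (act B (uθ y)))
      (hcs _ (by fun_prop) fun y hy => by simp [hu0 y hy]) i₁ fun y => ?_
    exact hwmul _ _ y (hasLineDerivAt_pair hu hθ B y (1, 0))
  have z₂ : ∫ y, g₂ y = 0 := by
    refine integral_lineDeriv_eq_zero (v := (0, 1))
      (g := fun y => (weight p y.1 : ℂ) * inner ℂ (u y) (act B (ux y)))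
      (hcs _ (by fun_prop) fun y hy => by simp [hu0 y hy]) i₂ fun y => ?_
    have h := hasLineDerivAt_pair hu hx B y (0, 1)
    unfold HasLineDerivAt at h ⊢
    simpa [hg₂] using h.const_mul (weight p y.1 : ℂ)
  have z₃ : ∫ y, g₃ y = 0 := by
    refine integral_lineDeriv_eq_zero (v := (1, 0))
      (g := fun y => ((κ / sin y.2 : ℝ) : ℂ) * ((weight p y.1 : ℂ) * inner ℂ (u y) (act D (u y))))
      (hcs _ (hk _ (by fun_prop) fun y hy => by simp [hu0 y hy]) fun y hy => by simp [hu0 y hy])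
      i₃ fun y => ?_
    have h := hwmul _ _ y (hasLineDerivAt_pair hu hu D y (1, 0))
    unfold HasLineDerivAt at h ⊢
    have h' := h.const_mul ((κ / sin y.2 : ℝ) : ℂ)
    simpa [hg₃] using h'
  -- In `g₁ - g₂` the mixed second derivatives cancel. As `B` is skew-Hermitian and `D` Hermitian,
  -- what is left combines to twice the real part of `⟨∂ₓu, rotated⟩`, plus the term with `w'`.
  have hsum : ∀ y, g₁ y - g₂ y + g₃ y = ((deriv (weight p) y.1 : ℝ) : ℂ) * inner ℂ (u y) (rotated κ u y)
      + (weight p y.1 : ℂ) * (inner ℂ (ux y) (rotated κ u y) + inner ℂ (rotated κ u y) (ux y)) := by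
    intro y
    have e1 : (inner ℂ (act B (uθ y)) (ux y) : ℂ) = -inner ℂ (uθ y) (act B (ux y)) := by
      rw [inner_act, hBt, act_neg_mat, inner_neg_right]
    have e2 : (inner ℂ (act D (u y)) (ux y) : ℂ) = inner ℂ (u y) (act D (ux y)) := by
      rw [inner_act, hDt]
    rw [rotated_eq]
    simp only [hg₁, hg₂, hg₃, inner_add_right, inner_add_left, inner_smul_left, inner_smul_right,
      Complex.conj_ofReal, ← hB, ← hD, e2, hsym]
    change _ = ((deriv (weight p) y.1 : ℝ) : ℂ) * (inner ℂ (u y) (act B (uθ y)) + _) + _ *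
      (inner ℂ (ux y) (act B (uθ y)) + _ + (inner ℂ (act B (uθ y)) (ux y) + _))
    rw [e1]
    ring
  have hint : Integrable fun y => g₁ y - g₂ y + g₃ y := (i₁.sub i₂).add i₃
  have htot : ∫ y, (g₁ y - g₂ y + g₃ y) = 0 := by
    have i₁₂ : Integrable fun y => g₁ y - g₂ y := i₁.sub i₂
    rw [integral_add i₁₂ i₃, integral_sub i₁ i₂, z₁, z₂, z₃]
    simp
  have hre : ∀ y, (g₁ y - g₂ y + g₃ y).re = deriv (weight p) y.1 *
      (inner ℂ (u y) (rotated κ u y) : ℂ).re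
      + 2 * weight p y.1 * (inner ℂ (ux y) (rotated κ u y) : ℂ).re := by
    intro y
    have h : (inner ℂ (rotated κ u y) (ux y) : ℂ).re = (inner ℂ (ux y) (rotated κ u y) : ℂ).re :=
      inner_re_symm (𝕜 := ℂ) (rotated κ u y) (ux y)
    rw [hsum]
    simp only [Complex.add_re, Complex.re_ofReal_mul, h]
    ring
  have hfun : (fun y => deriv (weight p) y.1 * (inner ℂ (u y) (rotated κ u y) : ℂ).re
      + 2 * weight p y.1 * (inner ℂ (fderiv ℝ u y (1, 0)) (rotated κ u y) : ℂ).re)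
      = fun y => (g₁ y - g₂ y + g₃ y).re := funext fun y => (hre y).symm
  rw [hfun]
  refine ⟨hint.re, ?_⟩
  exact (integral_re hint).trans (by rw [htot]; simp)

theorem IsTest.integrable_of_eq_zero {X : Type*} [NormedAddCommGroup X] {u : ℝ × ℝ → Spinor}
    (hu : IsTest u) {f : ℝ × ℝ → X} (hf : Continuous f) (h : ∀ y, y ∉ tsupport u → f y = 0) :
    Integrable f :=
  hf.integrable_of_hasCompactSupport (HasCompactSupport.intro hu.hasCompactSupport h)

theorem IsTest.integrable_norm_sq {u : ℝ × ℝ → Spinor} (hu : IsTest u) :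
    Integrable fun y => ‖u y‖ ^ 2 :=
  hu.integrable_of_eq_zero (hu.contDiff.continuous.norm.pow 2) fun y hy => by
    simp [IsTest.eq_zero hy]

theorem IsTest.integrable_norm_fderiv_sq {u : ℝ × ℝ → Spinor} (hu : IsTest u) (d : ℝ × ℝ) :
    Integrable fun y => ‖fderiv ℝ u y d‖ ^ 2 :=
  (hu.fderiv_apply d).integrable_norm_sq

theorem IsTest.integrable_norm_angular_sq {u : ℝ × ℝ → Spinor} (hu : IsTest u) (κ : ℝ) :
    Integrable fun y => ‖angular κ u y‖ ^ 2 :=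
  hu.integrable_of_eq_zero ((continuous_angular κ hu).norm.pow 2) fun y hy => by
    simp [angular_eq_zero κ hy]

theorem IsTest.integrable_norm_dirac_sq {u : ℝ × ℝ → Spinor} (hu : IsTest u) (p : Params)
    (hp : p.Admissible) (κ : ℝ) : Integrable fun y => ‖dirac p κ u y‖ ^ 2 :=
  hu.integrable_of_eq_zero ((continuous_dirac p hp κ hu).norm.pow 2) fun y hy => by
    simp [dirac_eq_zero p κ hy]

/-- Unlike `κ / sin θ`, the zeroth order coefficients are continuous up to the poles, so compactness
of the closed rectangle suffices. -/
theorem exists_norm_act_potential_le (p : Params) (hp : p.Admissible) (κ L : ℝ) :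
    ∃ C, ∀ y ∈ Icc (-L) L ×ˢ Icc 0 π, ∀ v, ‖act (potential p κ y) v‖ ≤ C * ‖v‖ := by
  have hr := continuous_radius p hp
  have hw := continuous_weight p hp
  have hr0 := fun x => (radius_sq_add_pos p hp x).ne'
  have hdiv : Continuous fun y : ℝ × ℝ =>
      (((p.a * κ + p.e * p.Q * radius p y.1) / (radius p y.1 ^ 2 + p.a ^ 2) : ℝ) : ℂ) :=
    Complex.continuous_ofReal.comp (Continuous.div (by fun_prop) (by fun_prop) fun _ => hr0 _)
  have hc : Continuous fun y => (Matrix.toEuclideanCLM (𝕜 := ℂ) (potential p κ y) :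
      Spinor →L[ℂ] Spinor) := by
    simp only [potential, map_add, map_sub, map_smul]
    fun_prop
  obtain ⟨C, hC⟩ := ((isCompact_Icc (a := -L) (b := L)).prod
    (isCompact_Icc (a := (0 : ℝ)) (b := π))).exists_bound_of_continuousOn hc.continuousOn
  exact ⟨C, fun y hy v => (ContinuousLinearMap.le_opNorm _ _).trans
    (mul_le_mul_of_nonneg_right (hC y hy) (norm_nonneg _))⟩

/-- On functions supported in a compact range of the radial coordinate the Dirac operator
controls the radial derivative and the angular operator separately. -/
theorem exists_integral_fderiv_add_angular_le (p : Params) (hp : p.Admissible) (κ L : ℝ) :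
    ∃ C, 0 ≤ C ∧ ∀ u, IsTest u → tsupport u ⊆ Icc (-L) L ×ˢ univ →
      (∫ y, ‖fderiv ℝ u y (1, 0)‖ ^ 2) + ∫ y, ‖angular κ u y‖ ^ 2
        ≤ C * ((∫ y, ‖u y‖ ^ 2) + ∫ y, ‖dirac p κ u y‖ ^ 2) := by
  have hw := contDiff_weight p hp
  have hw' : Continuous (deriv (weight p)) := hw.continuous_deriv le_rfl
  have hw0 := fun x => (weight_pos p hp x).ne'
  -- `B` bounds `1 / w`, `C₁` bounds `w' / w` and `C₂` bounds the potential, all on the range `[-L,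
  -- L]` of `x`.
  obtain ⟨B, hB⟩ := (isCompact_Icc (a := -L) (b := L)).exists_bound_of_continuousOn
    (hw.continuous.inv₀ hw0).continuousOn
  obtain ⟨C₁, hC₁⟩ := (isCompact_Icc (a := -L) (b := L)).exists_bound_of_continuousOn
    (hw'.div hw.continuous hw0).continuousOn
  obtain ⟨C₂, hC₂⟩ := exists_norm_act_potential_le p hp κ L
  set D := 2 + 2 * C₂ ^ 2 + C₁ ^ 2 / 2 with hD
  have hD0 : 0 ≤ D := by positivity
  refine ⟨(1 + 2 * B ^ 2) * D, by positivity, fun u hu hL => ?_⟩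
  obtain ⟨hi, hz⟩ := integral_re_inner_rotated p hp κ hu
  set q : ℝ × ℝ → ℝ := fun y => deriv (weight p) y.1 * (inner ℂ (u y) (rotated κ u y) : ℂ).re
      + 2 * weight p y.1 * (inner ℂ (fderiv ℝ u y (1, 0)) (rotated κ u y) : ℂ).re with hq
  -- The estimate is pointwise once `q` is subtracted on the right, and `q` has integral zero.
  have hpt : ∀ y, ‖fderiv ℝ u y (1, 0)‖ ^ 2 + ‖angular κ u y‖ ^ 2
      ≤ (1 + 2 * B ^ 2) * (D * ‖u y‖ ^ 2 + D * ‖dirac p κ u y‖ ^ 2 - q y) := by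
    intro y
    by_cases hy : y ∈ tsupport u
    swap
    · simp [hq, IsTest.eq_zero hy, fderiv_eq_zero hy, angular_eq_zero κ hy,
        dirac_eq_zero p κ hy]
    have hyx := (hL hy).1
    have hyθ := Ioo_subset_Icc_self (hu.tsupport_subset hy).2
    have hwp := weight_pos p hp y.1
    have b1 : 1 ≤ B * weight p y.1 := by
      have := (le_abs_self _).trans (hB _ hyx)
      rwa [Pi.inv_apply, inv_le_iff_one_le_mul₀ hwp] at this
    have b2 : |deriv (weight p) y.1| ≤ C₁ * weight p y.1 := by
      have := hC₁ _ hyx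
      rwa [Pi.div_apply, norm_div, Real.norm_eq_abs, Real.norm_of_nonneg hwp.le, div_le_iff₀ hwp] at this
    have b3 : ‖dirac₁ p κ u y‖ ≤ ‖dirac p κ u y‖ + C₂ * ‖u y‖ := by
      have e : dirac₁ p κ u y = dirac p κ u y - act (potential p κ y) (u y) := by
        simp [dirac]
      rw [e]
      exact (norm_sub_le _ _).trans (add_le_add le_rfl (hC₂ y ⟨hyx, hyθ⟩ _))
    have b4 : ‖dirac₁ p κ u y‖ ^ 2 ≤ 2 * ‖dirac p κ u y‖ ^ 2 + 2 * C₂ ^ 2 * ‖u y‖ ^ 2 := by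
      have := pow_le_pow_left₀ (norm_nonneg _) b3 2
      nlinarith [sq_nonneg (‖dirac p κ u y‖ - C₂ * ‖u y‖)]
    -- Young's inequality, with the constants chosen so that half of `w²‖A u‖²` absorbs the
    -- commutator term.
    have b5 : deriv (weight p) y.1 * (inner ℂ (u y) (rotated κ u y) : ℂ).re
        ≤ weight p y.1 ^ 2 * ‖angular κ u y‖ ^ 2 / 2 + C₁ ^ 2 / 2 * ‖u y‖ ^ 2 := by
      have h1 : |(inner ℂ (u y) (rotated κ u y) : ℂ).re| ≤ ‖u y‖ * ‖angular κ u y‖ := by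
        rw [← norm_rotated]
        exact (Complex.abs_re_le_norm _).trans (norm_inner_le_norm _ _)
      have h2 : |deriv (weight p) y.1 * (inner ℂ (u y) (rotated κ u y) : ℂ).re|
          ≤ (C₁ * weight p y.1) * (‖u y‖ * ‖angular κ u y‖) := by
        rw [abs_mul]
        exact mul_le_mul b2 h1 (abs_nonneg _) ((abs_nonneg _).trans b2)
      have h3 := (le_abs_self _).trans h2
      nlinarith [sq_nonneg (weight p y.1 * ‖angular κ u y‖ - C₁ * ‖u y‖)]
    have b6 := norm_dirac₁_sq p κ u y
    have b7 : ‖angular κ u y‖ ^ 2 ≤ B ^ 2 * (weight p y.1 ^ 2 * ‖angular κ u y‖ ^ 2) := by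
      rw [← mul_assoc, ← mul_pow]
      exact le_mul_of_one_le_left (sq_nonneg _) (one_le_pow₀ b1)
    have b8 : ‖fderiv ℝ u y (1, 0)‖ ^ 2 + weight p y.1 ^ 2 * ‖angular κ u y‖ ^ 2 / 2
        ≤ D * ‖u y‖ ^ 2 + D * ‖dirac p κ u y‖ ^ 2 - q y := by
      have e1 : (2 * C₂ ^ 2 + C₁ ^ 2 / 2) * ‖u y‖ ^ 2 ≤ D * ‖u y‖ ^ 2 := by
        gcongr
        rw [hD]
        linarith
      have e2 : 2 * ‖dirac p κ u y‖ ^ 2 ≤ D * ‖dirac p κ u y‖ ^ 2 := by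
        gcongr
        rw [hD]
        nlinarith [sq_nonneg C₁, sq_nonneg C₂]
      rw [hq]
      dsimp only
      linarith
    set F := ‖fderiv ℝ u y (1, 0)‖ ^ 2
    set W := weight p y.1 ^ 2 * ‖angular κ u y‖ ^ 2
    have hF : 0 ≤ F := by positivity
    have hW : 0 ≤ W := by positivity
    calc F + ‖angular κ u y‖ ^ 2 ≤ (1 + 2 * B ^ 2) * (F + W / 2) := by
          nlinarith [mul_nonneg (sq_nonneg B) hF]
      _ ≤ _ := mul_le_mul_of_nonneg_left b8 (by positivity)
  have i1 := hu.integrable_norm_fderiv_sq (1, 0)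
  have i2 := hu.integrable_norm_angular_sq κ
  have i3 := hu.integrable_norm_sq
  have i4 := hu.integrable_norm_dirac_sq p hp κ
  have i5 : Integrable fun y => D * ‖u y‖ ^ 2 + D * ‖dirac p κ u y‖ ^ 2 :=
    (i3.const_mul D).add (i4.const_mul D)
  have := integral_mono (i1.add i2) ((i5.sub hi).const_mul (1 + 2 * B ^ 2)) hpt
  rw [integral_const_mul] at this
  simp only [Pi.add_apply, Pi.sub_apply] at this
  rw [integral_add i1 i2, integral_sub i5 hi, hz, sub_zero,
    integral_add (i3.const_mul D) (i4.const_mul D), integral_const_mul, integral_const_mul] at this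
  linarith

/-! ### The angular operator near the poles -/

/-- A compactly supported function is bounded by the integral of a one-sided bound for its
derivative. -/
theorem le_integral_of_deriv_le {N q : ℝ → ℝ} (hN : ContDiff ℝ 1 N) (hc : HasCompactSupport N)
    (hq : Integrable q) (hq0 : ∀ t, 0 ≤ q t)
    (h : (∀ t, deriv N t ≤ q t) ∨ ∀ t, -deriv N t ≤ q t) (θ : ℝ) : N θ ≤ ∫ t, q t := by
  have hi : Integrable (deriv N) :=
    (hN.continuous_deriv le_rfl).integrable_of_hasCompactSupport hc.deriv
  -- An upper bound for the derivative is integrated from `-∞`, a lower bound from `+∞`.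
  rcases h with h | h
  · rw [← hc.integral_Iic_deriv_eq hN θ]
    exact (integral_mono hi.integrableOn hq.integrableOn h).trans
      (setIntegral_le_integral hq (Eventually.of_forall hq0))
  · have h1 := hc.integral_Ioi_deriv_eq hN θ
    have h2 : N θ = ∫ t in Ioi θ, -deriv N t := by rw [integral_neg, h1, neg_neg]
    rw [h2]
    exact (integral_mono hi.neg.integrableOn hq.integrableOn h).trans
      (setIntegral_le_integral hq (Eventually.of_forall hq0))

/-- The vector `∂_θ u + (κ / sin θ) diag(σ₃, σ₃) u`. -/
noncomputable def angularDeriv (κ : ℝ) (u : ℝ × ℝ → Spinor) (y : ℝ × ℝ) : Spinor :=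
  fderiv ℝ u y (0, 1) + ((κ / sin y.2 : ℝ) : ℂ) • act (Matrix.fromBlocks σ₃ 0 0 σ₃) (u y)

/-- Since `σ₁ σ₃ = -i σ₂`, factoring out the unitary `i σ₁` makes the singular term diagonal, and
the four components decouple. -/
theorem angular_eq (κ : ℝ) (u : ℝ × ℝ → Spinor) (y : ℝ × ℝ) :
    angular κ u y = Complex.I • act (pm σ₁) (angularDeriv κ u y) := by
  have h : pm σ₁ * Matrix.fromBlocks σ₃ 0 0 σ₃ = -Complex.I • pm σ₂ := by
    have h0 : σ₁ * σ₃ = -Complex.I • σ₂ := by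
      ext i j; fin_cases i <;> fin_cases j <;> simp [σ₁, σ₂, σ₃]
    rw [pm, pm, Matrix.fromBlocks_multiply, Matrix.fromBlocks_smul]
    simp [h0]
  simp only [angular, angularDeriv, act_add, act_smul, act_act, h, act_smul_mat, smul_add,
    smul_smul]
  congr 2
  linear_combination ((κ / sin y.2 : ℝ) : ℂ) * Complex.I_mul_I

theorem norm_angularDeriv (κ : ℝ) (u : ℝ × ℝ → Spinor) (y : ℝ × ℝ) :
    ‖angularDeriv κ u y‖ = ‖angular κ u y‖ := by
  rw [angular_eq, norm_smul, norm_act_pm σ₁_conjTranspose σ₁_mul_σ₁]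
  simp

/-- The signs on the diagonal of `diag(σ₃, σ₃)`. -/
def chirality : Fin 2 ⊕ Fin 2 → ℝ := Sum.elim ![1, -1] ![1, -1]

theorem act_fromBlocks_σ₃_apply (v : Spinor) (i : Fin 2 ⊕ Fin 2) :
    act (Matrix.fromBlocks σ₃ 0 0 σ₃) v i = chirality i * v i := by
  rcases i with i | i <;> fin_cases i <;>
    simp [act, Matrix.mulVec, dotProduct, σ₃, chirality]

theorem norm_act_fromBlocks_σ₃ (v : Spinor) : ‖act (Matrix.fromBlocks σ₃ 0 0 σ₃) v‖ = ‖v‖ := by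
  rw [EuclideanSpace.norm_eq, EuclideanSpace.norm_eq]
  congr 1
  refine Finset.sum_congr rfl fun i _ => ?_
  rw [act_fromBlocks_σ₃_apply]
  rcases i with i | i <;> fin_cases i <;> simp [chirality]

theorem continuous_angularDeriv (κ : ℝ) {u : ℝ × ℝ → Spinor} (hu : IsTest u) :
    Continuous (angularDeriv κ u) := by
  have h : angularDeriv κ u = fun y => -Complex.I • act (pm σ₁) (angular κ u y) := by
    funext y
    rw [angular_eq, act_smul, act_act, pm_mul_self σ₁_mul_σ₁, act_one, smul_smul]
    simp
  rw [h]
  exact ((continuous_act _).comp (continuous_angular κ hu)).const_smul (-Complex.I)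

theorem angularDeriv_eq_zero (κ : ℝ) {u : ℝ × ℝ → Spinor} {y : ℝ × ℝ} (hy : y ∉ tsupport u) :
    angularDeriv κ u y = 0 := by
  rw [← norm_eq_zero, norm_angularDeriv, angular_eq_zero κ hy, norm_zero]

/-- The angular operator controls the supremum over the angle. -/
theorem norm_sq_le_integral_angular (κ : ℝ) {u : ℝ × ℝ → Spinor} (hu : IsTest u) (x θ : ℝ) :
    ‖u (x, θ)‖ ^ 2 ≤ ∫ t, (‖u (x, t)‖ ^ 2 + ‖angular κ u (x, t)‖ ^ 2) := by
  have hK : IsCompact (Prod.snd '' tsupport u) := hu.hasCompactSupport.isCompact.image continuous_snd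
  have hnot : ∀ t, t ∉ Prod.snd '' tsupport u → (x, t) ∉ tsupport u := fun t ht h =>
    ht ⟨(x, t), h, rfl⟩
  have hg := continuous_angularDeriv κ hu
  have huc := hu.contDiff.continuous
  have hcomp : ∀ i, ‖u (x, θ) i‖ ^ 2
      ≤ ∫ t, (‖u (x, t) i‖ ^ 2 + ‖angularDeriv κ u (x, t) i‖ ^ 2) := by
    intro i
    set f : ℝ → ℂ := fun t => u (x, t) i with hf
    have hfd : ContDiff ℝ ∞ f := by
      have := hu.contDiff
      have h1 : ContDiff ℝ ∞ fun t : ℝ => u (x, t) := this.comp (by fun_prop)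
      exact ((EuclideanSpace.proj (𝕜 := ℂ) i).restrictScalars ℝ).contDiff.comp h1
    have hf' : ∀ t, HasDerivAt f (fderiv ℝ u (x, t) (0, 1) i) t := by
      intro t
      have h1 : HasDerivAt (fun t : ℝ => u (x, t)) (fderiv ℝ u (x, t) (0, 1)) t :=
        (hu.differentiable (x, t)).hasFDerivAt.comp_hasDerivAt t
          ((hasDerivAt_const t x).prodMk (hasDerivAt_id t))
      exact ((EuclideanSpace.proj (𝕜 := ℂ) i).restrictScalars ℝ).hasFDerivAt.comp_hasDerivAt t h1
    have hder : ∀ t, deriv (fun t => ‖f t‖ ^ 2) t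
        = 2 * inner ℝ (f t) (fderiv ℝ u (x, t) (0, 1) i) := fun t => (hf' t).norm_sq.deriv
    have hgi : ∀ t, fderiv ℝ u (x, t) (0, 1) i
        = angularDeriv κ u (x, t) i - ((κ / sin t * chirality i : ℝ) : ℂ) * f t := by
      intro t
      simp [angularDeriv, act_fromBlocks_σ₃_apply, hf, mul_assoc]
    -- The singular term enters the derivative of `‖f‖²` as a multiple of `‖f‖²` whose sign is that
    -- of `-κ * chirality i` on the whole interval.
    have hin : ∀ t, t ∈ Ioo 0 π → deriv (fun t => ‖f t‖ ^ 2) t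
        = 2 * inner ℝ (f t) (angularDeriv κ u (x, t) i)
          - 2 * (κ / sin t * chirality i) * ‖f t‖ ^ 2 := by
      intro t ht
      rw [hder, hgi t, inner_sub_right, ← Complex.real_smul, inner_smul_right,
        real_inner_self_eq_norm_sq]
      ring
    have hout : ∀ t, t ∉ Ioo 0 π → deriv (fun t => ‖f t‖ ^ 2) t = 0 := by
      intro t ht
      rw [hder, fderiv_eq_zero fun h => ht (hu.tsupport_subset h).2]
      simp
    refine le_integral_of_deriv_le (N := fun t => ‖f t‖ ^ 2) ?_ ?_ ?_ (fun t => by positivity) ?_ θ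
    · exact (hfd.norm_sq ℝ).of_le (by simp)
    · exact HasCompactSupport.intro hK fun t ht => by simp [hf, IsTest.eq_zero (hnot t ht)]
    · refine Continuous.integrable_of_hasCompactSupport (by fun_prop)
        (HasCompactSupport.intro hK fun t ht => ?_)
      simp [IsTest.eq_zero (hnot t ht), angularDeriv_eq_zero κ (hnot t ht)]
    · have hb : ∀ t, |2 * inner ℝ (f t) (angularDeriv κ u (x, t) i)|
          ≤ ‖f t‖ ^ 2 + ‖angularDeriv κ u (x, t) i‖ ^ 2 := by
        intro t
        have := abs_real_inner_le_norm (f t) (angularDeriv κ u (x, t) i)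
        rw [abs_mul, abs_two]
        nlinarith [sq_nonneg (‖f t‖ - ‖angularDeriv κ u (x, t) i‖)]
      have hs : ∀ t ∈ Ioo 0 π, 0 < sin t := fun t ht => sin_pos_of_mem_Ioo ht
      -- The sign decides from which end to integrate: the singular term is discarded from the upper
      -- bound of the derivative in the first case, and from that of its negative in the second.
      rcases le_total 0 (κ * chirality i) with hk | hk
      · left
        intro t
        by_cases ht : t ∈ Ioo 0 π
        · have h1 : 0 ≤ κ / sin t * chirality i := by
            rw [div_mul_eq_mul_div]
            exact div_nonneg hk (hs t ht).le
          have h2 := (le_abs_self _).trans (hb t)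
          rw [hin t ht]
          have := mul_nonneg h1 (sq_nonneg ‖f t‖)
          linarith
        · rw [hout t ht]
          positivity
      · right
        intro t
        by_cases ht : t ∈ Ioo 0 π
        · have h1 : κ / sin t * chirality i ≤ 0 := by
            rw [div_mul_eq_mul_div]
            exact div_nonpos_of_nonpos_of_nonneg hk (hs t ht).le
          have h2 := (neg_le_abs _).trans (hb t)
          rw [hin t ht]
          have := mul_nonneg_of_nonpos_of_nonpos h1 (neg_nonpos.2 (sq_nonneg ‖f t‖))
          linarith
        · rw [hout t ht]
          simp only [neg_zero]
          positivity
  simp_rw [← norm_angularDeriv, EuclideanSpace.norm_sq_eq, ← Finset.sum_add_distrib]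
  rw [integral_finsetSum]
  · exact Finset.sum_le_sum fun i _ => hcomp i
  · intro i _
    refine Continuous.integrable_of_hasCompactSupport (by fun_prop)
      (HasCompactSupport.intro hK fun t ht => ?_)
    simp [IsTest.eq_zero (hnot t ht), angularDeriv_eq_zero κ (hnot t ht)]

/-- The supremum bound in `θ` is integrated over `T`, which costs the length of `T`, and then over
`x`. -/
theorem setIntegral_strip_le (κ : ℝ) {u : ℝ × ℝ → Spinor} (hu : IsTest u) {T : Set ℝ}
    (hTfin : volume T ≠ ⊤) :
    ∫ y in univ ×ˢ T, ‖u y‖ ^ 2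
      ≤ volume.real T * ((∫ y, ‖u y‖ ^ 2) + ∫ y, ‖angular κ u y‖ ^ 2) := by
  have i1 := hu.integrable_norm_sq
  have i2 := hu.integrable_norm_angular_sq κ
  have i3 : Integrable (fun y => ‖u y‖ ^ 2 + ‖angular κ u y‖ ^ 2) (volume.prod volume) := i1.add i2
  rw [← integral_add i1 i2, Measure.volume_eq_prod, setIntegral_prod _ i1.integrableOn,
    Measure.restrict_univ, integral_prod _ i3, ← integral_const_mul]
  have i4 : Integrable (fun y => ‖u y‖ ^ 2) (volume.prod (volume.restrict T)) := by
    have := i1.integrableOn (s := univ ×ˢ T)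
    rwa [IntegrableOn, Measure.volume_eq_prod, ← Measure.prod_restrict, Measure.restrict_univ]
      at this
  refine integral_mono i4.integral_prod_left (i3.integral_prod_left.const_mul _) fun x => ?_
  calc ∫ θ in T, ‖u (x, θ)‖ ^ 2
      ≤ ∫ _ in T, ∫ t, (‖u (x, t)‖ ^ 2 + ‖angular κ u (x, t)‖ ^ 2) := by
        have hT : IsFiniteMeasure (volume.restrict T) := ⟨by
          rw [Measure.restrict_apply_univ]; exact hTfin.lt_top⟩
        refine integral_mono_of_nonneg (Eventually.of_forall fun θ => by positivity)
          (integrable_const _) (Eventually.of_forall fun θ => ?_)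
        exact norm_sq_le_integral_angular κ hu x θ
    _ = _ := by rw [setIntegral_const, smul_eq_mul]

/-- The two strips of width `δ` along the axis. -/
def polarStrip (δ : ℝ) : Set ℝ := Ioo 0 δ ∪ Ioo (π - δ) π

theorem volume_polarStrip_ne_top (δ : ℝ) : volume (polarStrip δ) ≠ ⊤ :=
  ((measure_union_le _ _).trans_lt (ENNReal.add_lt_top.2
    ⟨measure_Ioo_lt_top, measure_Ioo_lt_top⟩)).ne

theorem volume_real_polarStrip_le {δ : ℝ} (hδ : 0 ≤ δ) : volume.real (polarStrip δ) ≤ 2 * δ := by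
  refine (measureReal_union_le _ _).trans (le_of_eq ?_)
  rw [Real.volume_real_Ioo_of_le hδ, Real.volume_real_Ioo_of_le (by linarith)]
  ring

theorem sin_le_sin_of_notMem_polarStrip {δ t : ℝ} (hδ : 0 ≤ δ) (hδ' : δ ≤ π / 2)
    (ht : t ∈ Ioo 0 π) (hn : t ∉ polarStrip δ) : sin δ ≤ sin t := by
  simp only [polarStrip, mem_union, mem_Ioo, not_or, not_and, not_lt] at hn
  have h1 : δ ≤ t := hn.1 ht.1
  have h2 : t ≤ π - δ := by
    by_contra! h
    exact absurd (hn.2 h) (not_le.2 ht.2)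
  rcases le_total t (π / 2) with h | h
  · exact sin_le_sin_of_le_of_le_pi_div_two (by linarith) h h1
  · rw [← sin_pi_sub t]
    exact sin_le_sin_of_le_of_le_pi_div_two (by linarith) (by linarith) (by linarith)

/-- Near the axis the strip estimate makes the contribution small; elsewhere `sin θ ≥ sin δ` permits
the passage to `sin θ • u`. -/
theorem integral_norm_sq_le_strip (κ : ℝ) {u : ℝ × ℝ → Spinor} (hu : IsTest u) {δ : ℝ}
    (hδ : 0 < δ) (hδ' : δ ≤ π / 2) :
    ∫ y, ‖u y‖ ^ 2 ≤ 2 * δ * ((∫ y, ‖u y‖ ^ 2) + ∫ y, ‖angular κ u y‖ ^ 2)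
      + (sin δ ^ 2)⁻¹ * ∫ y, ‖sin y.2 • u y‖ ^ 2 := by
  have hs : 0 < sin δ := sin_pos_of_pos_of_lt_pi hδ (by linarith [pi_pos])
  have i1 := hu.integrable_norm_sq
  have huc := hu.contDiff.continuous
  have i2 : Integrable fun y => ‖sin y.2 • u y‖ ^ 2 :=
    hu.integrable_of_eq_zero (by fun_prop) fun y hy => by simp [IsTest.eq_zero hy]
  have hm : MeasurableSet (univ ×ˢ polarStrip δ : Set (ℝ × ℝ)) :=
    MeasurableSet.univ.prod (measurableSet_Ioo.union measurableSet_Ioo)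
  have hpt : ∀ y : ℝ × ℝ, ‖u y‖ ^ 2 ≤ (univ ×ˢ polarStrip δ).indicator (fun y => ‖u y‖ ^ 2) y
      + (sin δ ^ 2)⁻¹ * ‖sin y.2 • u y‖ ^ 2 := by
    intro y
    by_cases hy : y ∈ tsupport u
    swap
    · simp [IsTest.eq_zero hy, indicator]
    by_cases hyT : y ∈ (univ ×ˢ polarStrip δ : Set (ℝ × ℝ))
    · rw [indicator_of_mem hyT]
      have : 0 ≤ (sin δ ^ 2)⁻¹ * ‖sin y.2 • u y‖ ^ 2 := by positivity
      linarith
    · rw [indicator_of_notMem hyT, zero_add, norm_smul, mul_pow, ← mul_assoc]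
      refine le_mul_of_one_le_left (sq_nonneg _) ?_
      rw [le_inv_mul_iff₀ (by positivity), mul_one]
      refine pow_le_pow_left₀ hs.le ?_ 2
      refine (sin_le_sin_of_notMem_polarStrip hδ.le hδ' (hu.tsupport_subset hy).2
        fun h => hyT ⟨trivial, h⟩).trans (le_abs_self _)
  have := integral_mono i1 ((i1.indicator hm).add (i2.const_mul (sin δ ^ 2)⁻¹)) hpt
  simp only [Pi.add_apply] at this
  rw [integral_add (i1.indicator hm) (i2.const_mul _), integral_indicator hm,
    integral_const_mul] at this
  refine this.trans (add_le_add ((setIntegral_strip_le κ hu (volume_polarStrip_ne_top δ)).trans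
    (mul_le_mul_of_nonneg_right (volume_real_polarStrip_le hδ.le) ?_)) le_rfl)
  exact add_nonneg (integral_nonneg fun _ => by positivity) (integral_nonneg fun _ => by positivity)

/-! ### Control by finitely many averages -/

/-- The vector on the left is `∂_θ(sin θ • u)`. The weight `sin θ` turns `κ / sin θ` into the
bounded coefficient `κ`, which is why averages of `sin θ • u` rather than of `u` are used. -/
theorem norm_deriv_sin_smul_sq_le (κ : ℝ) {u : ℝ × ℝ → Spinor} (hu : IsTest u) (y : ℝ × ℝ) :
    ‖cos y.2 • u y + sin y.2 • fderiv ℝ u y (0, 1)‖ ^ 2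
      ≤ 2 * (1 + |κ|) ^ 2 * ‖u y‖ ^ 2 + 2 * ‖angular κ u y‖ ^ 2 := by
  by_cases hy : y ∈ tsupport u
  swap
  · simp [IsTest.eq_zero hy, fderiv_eq_zero hy, angular_eq_zero κ hy]
  have hs := (sin_pos_of_mem_Ioo (hu.tsupport_subset hy).2).ne'
  have h1 : sin y.2 • fderiv ℝ u y (0, 1) = sin y.2 • angularDeriv κ u y
      - κ • act (Matrix.fromBlocks σ₃ 0 0 σ₃) (u y) := by
    rw [angularDeriv, smul_add, Complex.coe_smul, smul_smul, mul_div_cancel₀ _ hs,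
      add_sub_cancel_right]
  have h2 : ‖cos y.2 • u y + sin y.2 • fderiv ℝ u y (0, 1)‖
      ≤ (1 + |κ|) * ‖u y‖ + ‖angular κ u y‖ := by
    rw [h1]
    have a1 : ‖cos y.2 • u y‖ ≤ ‖u y‖ := by
      rw [norm_smul]
      exact mul_le_of_le_one_left (norm_nonneg _) (abs_cos_le_one _)
    have a2 : ‖sin y.2 • angularDeriv κ u y‖ ≤ ‖angular κ u y‖ := by
      rw [norm_smul, norm_angularDeriv]
      exact mul_le_of_le_one_left (norm_nonneg _) (abs_sin_le_one _)
    have a3 : ‖κ • act (Matrix.fromBlocks σ₃ 0 0 σ₃) (u y)‖ = |κ| * ‖u y‖ := by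
      rw [norm_smul, norm_act_fromBlocks_σ₃, Real.norm_eq_abs]
    have a4 := norm_add_le (cos y.2 • u y) (sin y.2 • angularDeriv κ u y
      - κ • act (Matrix.fromBlocks σ₃ 0 0 σ₃) (u y))
    have a5 := norm_sub_le (sin y.2 • angularDeriv κ u y)
      (κ • act (Matrix.fromBlocks σ₃ 0 0 σ₃) (u y))
    linarith
  have h3 := pow_le_pow_left₀ (norm_nonneg _) h2 2
  nlinarith [sq_nonneg ((1 + |κ|) * ‖u y‖ - ‖angular κ u y‖)]

/-- Up to an arbitrarily small multiple of the graph norm, the `L²` norm of a test function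
supported in a compact range of the radial coordinate is controlled by finitely many averages. -/
theorem exists_integral_norm_sq_le_averages (p : Params) (hp : p.Admissible) (κ L : ℝ) {ε : ℝ}
    (hε : 0 < ε) : ∃ (s : Finset (ℕ × ℤ × ℤ)) (c : ℝ), 0 ≤ c ∧ ∀ u, IsTest u →
      tsupport u ⊆ Icc (-L) L ×ˢ univ →
      ∫ y, ‖u y‖ ^ 2 ≤ ε * ((∫ y, ‖u y‖ ^ 2) + ∫ y, ‖dirac p κ u y‖ ^ 2)
        + c * ∑ i ∈ s, ‖∫ y in gridCell i, sin y.2 • u y‖ ^ 2 := by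
  obtain ⟨C, hC0, hC⟩ := exists_integral_fderiv_add_angular_le p hp κ L
  obtain ⟨δ, hδ, hδ', hδε⟩ : ∃ δ, 0 < δ ∧ δ ≤ π / 2 ∧ 2 * δ * (1 + C) ≤ ε / 2 := by
    -- The polar strips use up half of `ε`; the factor `1 + C` comes from bounding `∫ (‖u‖² + ‖A
    -- u‖²)` by the squared graph norm.
    refine ⟨min (π / 2) (ε / 2 / (2 * (1 + C))), by positivity, min_le_left _ _, ?_⟩
    calc 2 * min (π / 2) (ε / 2 / (2 * (1 + C))) * (1 + C)
        ≤ 2 * (ε / 2 / (2 * (1 + C))) * (1 + C) := by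
          gcongr
          exact min_le_right _ _
      _ = ε / 2 := by field_simp
  have hs : 0 < sin δ := sin_pos_of_pos_of_lt_pi hδ (by linarith [pi_pos])
  set C' := 2 * (1 + |κ|) ^ 2 + 2 * C with hC'
  have hC'0 : 0 ≤ C' := by positivity
  -- The mesh is chosen after `δ`, fine enough to compensate the loss `(sin δ)⁻²`; `C'` bounds the
  -- gradient of `sin θ • u` by the squared graph norm. This uses the other half of `ε`.
  obtain ⟨N, hN⟩ : ∃ N : ℕ, (sin δ ^ 2)⁻¹ * (3 * (((N : ℝ) + 1) ^ 2)⁻¹ * C') ≤ ε / 2 := by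
    obtain ⟨N, hN⟩ := exists_nat_ge ((sin δ ^ 2)⁻¹ * (3 * C') / (ε / 2))
    refine ⟨N, ?_⟩
    rw [div_le_iff₀ (by positivity)] at hN
    have h1 : (N : ℝ) ≤ ((N : ℝ) + 1) ^ 2 := by nlinarith [N.cast_nonneg (α := ℝ)]
    calc (sin δ ^ 2)⁻¹ * (3 * (((N : ℝ) + 1) ^ 2)⁻¹ * C')
        = (((N : ℝ) + 1) ^ 2)⁻¹ * ((sin δ ^ 2)⁻¹ * (3 * C')) := by ring
      _ ≤ (((N : ℝ) + 1) ^ 2)⁻¹ * (((N : ℝ) + 1) ^ 2 * (ε / 2)) := by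
        refine mul_le_mul_of_nonneg_left (hN.trans ?_) (by positivity)
        gcongr
      _ = ε / 2 := by field_simp
  obtain ⟨s, hgrid⟩ := integral_norm_sq_le_grid (E := Spinor) N (K := Icc (-L) L ×ˢ Icc 0 π)
    (isCompact_Icc.prod isCompact_Icc).isBounded
  refine ⟨s, (sin δ ^ 2)⁻¹ * (3 * ((N : ℝ) + 1) ^ 2), by positivity, fun u hu hL => ?_⟩
  have huc := hu.contDiff.continuous
  have hxc := (hu.fderiv_apply (1, 0)).contDiff.continuous
  have hθc := (hu.fderiv_apply (0, 1)).contDiff.continuous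
  have hux : ∀ y : ℝ × ℝ, HasDerivAt (fun s => u (s, y.2)) (fderiv ℝ u y (1, 0)) y.1 := fun y =>
    HasFDerivAt.comp_hasDerivAt (l := u) y.1 (hu.differentiable y).hasFDerivAt
      ((hasDerivAt_id y.1).prodMk (hasDerivAt_const y.1 y.2))
  have huθ : ∀ y : ℝ × ℝ, HasDerivAt (fun t => u (y.1, t)) (fderiv ℝ u y (0, 1)) y.2 := fun y =>
    HasFDerivAt.comp_hasDerivAt (l := u) y.2 (hu.differentiable y).hasFDerivAt
      ((hasDerivAt_const y.2 y.1).prodMk (hasDerivAt_id y.2))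
  have j1 := hu.integrable_norm_sq
  have j2 := hu.integrable_norm_fderiv_sq (1, 0)
  have j3 := hu.integrable_norm_angular_sq κ
  have jx : Integrable fun y : ℝ × ℝ => ‖sin y.2 • fderiv ℝ u y (1, 0)‖ ^ 2 :=
    hu.integrable_of_eq_zero (by fun_prop) fun y hy => by simp [fderiv_eq_zero hy]
  have jθ : Integrable fun y : ℝ × ℝ => ‖cos y.2 • u y + sin y.2 • fderiv ℝ u y (0, 1)‖ ^ 2 :=
    hu.integrable_of_eq_zero (by fun_prop) fun y hy => by
      simp [fderiv_eq_zero hy, IsTest.eq_zero hy]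
  have hG := hgrid (fun y => sin y.2 • u y) (fun y => sin y.2 • fderiv ℝ u y (1, 0))
    (fun y => cos y.2 • u y + sin y.2 • fderiv ℝ u y (0, 1)) (by fun_prop)
    (fun y => (hux y).const_smul (sin y.2)) (by fun_prop)
    (fun y => by
      rw [add_comm]
      exact (hasDerivAt_sin y.2).smul (huθ y)) (by fun_prop) jx jθ
    (fun y hy => by
      have : y ∉ tsupport u := fun h =>
        hy ⟨(hL h).1, Ioo_subset_Icc_self (hu.tsupport_subset h).2⟩
      simp [IsTest.eq_zero this])
  have hell := hC u hu hL
  have hgx : ∫ y : ℝ × ℝ, ‖sin y.2 • fderiv ℝ u y (1, 0)‖ ^ 2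
      ≤ ∫ y, ‖fderiv ℝ u y (1, 0)‖ ^ 2 := by
    refine integral_mono jx j2 fun y => pow_le_pow_left₀ (norm_nonneg _) ?_ 2
    rw [norm_smul]
    exact mul_le_of_le_one_left (norm_nonneg _) (abs_sin_le_one _)
  have hgθ : ∫ y : ℝ × ℝ, ‖cos y.2 • u y + sin y.2 • fderiv ℝ u y (0, 1)‖ ^ 2
      ≤ 2 * (1 + |κ|) ^ 2 * (∫ y, ‖u y‖ ^ 2) + 2 * ∫ y, ‖angular κ u y‖ ^ 2 := by
    have := integral_mono jθ ((j1.const_mul _).add (j3.const_mul _))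
      (norm_deriv_sin_smul_sq_le κ hu)
    simp only [Pi.add_apply] at this
    rwa [integral_add (j1.const_mul _) (j3.const_mul _), integral_const_mul,
      integral_const_mul] at this
  have hstrip := integral_norm_sq_le_strip κ hu hδ hδ'
  have n1 : 0 ≤ ∫ y, ‖u y‖ ^ 2 := integral_nonneg fun _ => by positivity
  have n2 : 0 ≤ ∫ y, ‖fderiv ℝ u y (1, 0)‖ ^ 2 := integral_nonneg fun _ => by positivity
  have n3 : 0 ≤ ∫ y, ‖angular κ u y‖ ^ 2 := integral_nonneg fun _ => by positivity
  have n4 : 0 ≤ ∫ y, ‖dirac p κ u y‖ ^ 2 := integral_nonneg fun _ => by positivity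
  set I := ∫ y, ‖u y‖ ^ 2
  set Ix := ∫ y, ‖fderiv ℝ u y (1, 0)‖ ^ 2
  set Ia := ∫ y, ‖angular κ u y‖ ^ 2
  set Id := ∫ y, ‖dirac p κ u y‖ ^ 2
  set A := ∑ i ∈ s, ‖∫ y in gridCell i, sin y.2 • u y‖ ^ 2
  have e1 : 2 * δ * (I + Ia) ≤ ε / 2 * (I + Id) :=
    calc 2 * δ * (I + Ia) ≤ 2 * δ * ((1 + C) * (I + Id)) := by
          gcongr
          linarith
      _ = 2 * δ * (1 + C) * (I + Id) := by ring
      _ ≤ _ := by gcongr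
  have e2 : (∫ y : ℝ × ℝ, ‖sin y.2 • fderiv ℝ u y (1, 0)‖ ^ 2)
      + ∫ y : ℝ × ℝ, ‖cos y.2 • u y + sin y.2 • fderiv ℝ u y (0, 1)‖ ^ 2 ≤ C' * (I + Id) := by
    have : 0 ≤ 2 * (1 + |κ|) ^ 2 * Id := by positivity
    rw [hC']
    linarith
  have e3 : (sin δ ^ 2)⁻¹ * ∫ y, ‖sin y.2 • u y‖ ^ 2
      ≤ (sin δ ^ 2)⁻¹ * (3 * ((N : ℝ) + 1) ^ 2) * A + ε / 2 * (I + Id) :=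
    calc (sin δ ^ 2)⁻¹ * ∫ y, ‖sin y.2 • u y‖ ^ 2
        ≤ (sin δ ^ 2)⁻¹ * (3 * ((N : ℝ) + 1) ^ 2 * A
          + 3 * (((N : ℝ) + 1) ^ 2)⁻¹ * (C' * (I + Id))) := by
          refine mul_le_mul_of_nonneg_left (hG.trans ?_) (by positivity)
          gcongr
      _ = (sin δ ^ 2)⁻¹ * (3 * ((N : ℝ) + 1) ^ 2) * A
          + (sin δ ^ 2)⁻¹ * (3 * (((N : ℝ) + 1) ^ 2)⁻¹ * C') * (I + Id) := by ring
      _ ≤ _ := by gcongr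
  linarith

/-! ### Cutoff in the radial coordinate and bounds for the averages -/

section Cutoff

variable {χ : ℝ → ℝ} {u : ℝ × ℝ → Spinor}

theorem IsTest.cutoff (hχ : ContDiff ℝ ∞ χ) (hu : IsTest u) :
    IsTest fun y => χ y.1 • u y where
  contDiff := (hχ.comp contDiff_fst).smul hu.contDiff
  hasCompactSupport := hu.hasCompactSupport.smul_left (f := fun y : ℝ × ℝ => χ y.1)
  tsupport_subset :=
    (tsupport_smul_subset_right (fun y : ℝ × ℝ => χ y.1) u).trans hu.tsupport_subset

/-- A cutoff depending on `x` alone commutes with the angular part, so the commutator is the bounded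
matrix `-i χ' σ₃`. -/
theorem dirac_cutoff (hχ : ContDiff ℝ ∞ χ) (hu : IsTest u) (p : Params) (κ : ℝ) (y : ℝ × ℝ) :
    dirac p κ (fun y => χ y.1 • u y) y
      = χ y.1 • dirac p κ u y - deriv χ y.1 • Complex.I • act (pm σ₃) (u y) := by
  have h1 : HasFDerivAt (fun y : ℝ × ℝ => χ y.1)
      (deriv χ y.1 • ContinuousLinearMap.fst ℝ ℝ ℝ) y :=
    ((hχ.differentiable (by simp) y.1).hasDerivAt).comp_hasFDerivAt y hasFDerivAt_fst
  have h2 : fderiv ℝ (fun y => χ y.1 • u y) y = _ := (h1.smul (hu.differentiable y).hasFDerivAt).fderiv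
  simp only [dirac, dirac₁, ← Complex.coe_smul]
  have e1 : fderiv ℝ (fun y => (χ y.1 : ℂ) • u y) y (1, 0)
      = (χ y.1 : ℂ) • fderiv ℝ u y (1, 0) + ((deriv χ y.1 : ℝ) : ℂ) • u y := by
    simp only [Complex.coe_smul]
    rw [h2]
    simp
  have e2 : fderiv ℝ (fun y => (χ y.1 : ℂ) • u y) y (0, 1) = (χ y.1 : ℂ) • fderiv ℝ u y (0, 1) := by
    simp only [Complex.coe_smul]
    rw [h2]
    simp
  rw [e1, e2]
  simp only [act_add, act_smul, smul_add]
  module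

theorem exists_cutoff {R : ℝ} (hR : 0 < R) : ∃ χ : ℝ → ℝ, ContDiff ℝ ∞ χ ∧
    (∀ x ∈ Ioo (-R) R, χ x = 1) ∧ (∀ x, |χ x| ≤ 1) ∧ (∀ x, x ∉ Icc (-(R + 1)) (R + 1) → χ x = 0) ∧
    ∃ C, ∀ x, |deriv χ x| ≤ C := by
  set φ : ContDiffBump (0 : ℝ) := ⟨R, R + 1, hR, by linarith⟩ with hφ
  refine ⟨φ, φ.contDiff, fun x hx => φ.one_of_mem_closedBall ?_, fun x => ?_, fun x hx => ?_, ?_⟩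
  · rw [mem_closedBall_zero_iff, Real.norm_eq_abs, abs_le]
    exact ⟨hx.1.le, hx.2.le⟩
  · rw [abs_of_nonneg φ.nonneg]
    exact φ.le_one
  · refine φ.zero_of_le_dist ?_
    rw [dist_zero_right, Real.norm_eq_abs]
    by_contra! h
    exact hx ⟨(abs_le.1 h.le).1, (abs_le.1 h.le).2⟩
  · have h1 : ContDiff ℝ ∞ φ := φ.contDiff
    obtain ⟨C, hC⟩ := φ.hasCompactSupport.deriv.exists_bound_of_continuous
      (h1.continuous_deriv (by simp))
    exact ⟨C, hC⟩

end Cutoff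

/-- The averages of `χ(x) sin θ u` over the squares of the grids. -/
noncomputable def average (χ : ℝ → ℝ) (u : ℝ × ℝ → Spinor) (i : ℕ × ℤ × ℤ) : Spinor :=
  ∫ y in gridCell i, sin y.2 • χ y.1 • u y

theorem measurableSet_Ω₂R (R : ℝ) : MeasurableSet (Ω₂R R) := measurableSet_Ioo.prod measurableSet_Ioo

/-- The estimate for compact ranges of `x` is applied to `χ u`, which equals `u` on `Ω_{2,R}`. The
set `s` and the constant `c` depend on `ε` and the cutoff but not on `u`. -/
theorem exists_setIntegral_norm_sq_le_averages (p : Params) (hp : p.Admissible) (κ : ℝ) {R : ℝ}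
    {χ : ℝ → ℝ} (hχ : ContDiff ℝ ∞ χ) (h1 : ∀ x ∈ Ioo (-R) R, χ x = 1) (hle : ∀ x, |χ x| ≤ 1)
    {L : ℝ} (h0 : ∀ x, x ∉ Icc (-L) L → χ x = 0) {C : ℝ} (hC : ∀ x, |deriv χ x| ≤ C)
    {ε : ℝ} (hε : 0 < ε) : ∃ (s : Finset (ℕ × ℤ × ℤ)) (c : ℝ), 0 ≤ c ∧ ∀ u, IsTest u →
      ∫ y in Ω₂R R, ‖u y‖ ^ 2 ≤ ε * ((∫ y, ‖u y‖ ^ 2) + ∫ y, ‖dirac p κ u y‖ ^ 2)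
        + c * ∑ i ∈ s, ‖average χ u i‖ ^ 2 := by
  -- The squared graph norm of `χ u` is at most `2 + 2 * C ^ 2` times that of `u`.
  obtain ⟨s, c, hc, hs⟩ := exists_integral_norm_sq_le_averages p hp κ L
    (ε := ε / (2 + 2 * C ^ 2)) (by positivity)
  refine ⟨s, c, hc, fun u hu => ?_⟩
  have hv := hu.cutoff hχ
  have key := hs _ hv (fun y hy => by
    have hsub : tsupport (fun y : ℝ × ℝ => χ y.1 • u y) ⊆ Icc (-L) L ×ˢ univ :=
      closure_minimal (fun z hz => ⟨by_contra fun h => hz (by simp [h0 _ h]), trivial⟩)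
        (isClosed_Icc.prod isClosed_univ)
    exact hsub hy)
  have j1 := hu.integrable_norm_sq
  have j2 := hu.integrable_norm_dirac_sq p hp κ
  have j3 := hv.integrable_norm_sq
  have j4 := hv.integrable_norm_dirac_sq p hp κ
  have a1 : ∫ y in Ω₂R R, ‖u y‖ ^ 2 ≤ ∫ y, ‖χ y.1 • u y‖ ^ 2 := by
    calc ∫ y in Ω₂R R, ‖u y‖ ^ 2 = ∫ y in Ω₂R R, ‖χ y.1 • u y‖ ^ 2 :=
          setIntegral_congr_fun (measurableSet_Ω₂R R) fun y hy => by
            simp only [h1 _ hy.1, one_smul]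
      _ ≤ _ := setIntegral_le_integral j3 (Eventually.of_forall fun _ => by positivity)
  have b1 : ∀ y : ℝ × ℝ, ‖χ y.1 • u y‖ ≤ ‖u y‖ := fun y => by
    rw [norm_smul]
    exact mul_le_of_le_one_left (norm_nonneg _) (hle _)
  have b2 : ∀ y : ℝ × ℝ, ‖dirac p κ (fun y => χ y.1 • u y) y‖ ^ 2
      ≤ 2 * ‖dirac p κ u y‖ ^ 2 + 2 * C ^ 2 * ‖u y‖ ^ 2 := by
    intro y
    have e1 : ‖χ y.1 • dirac p κ u y‖ ≤ ‖dirac p κ u y‖ := by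
      rw [norm_smul]
      exact mul_le_of_le_one_left (norm_nonneg _) (hle _)
    have e2 : ‖deriv χ y.1 • Complex.I • act (pm σ₃) (u y)‖ ≤ C * ‖u y‖ := by
      rw [norm_smul, norm_smul, norm_act_pm σ₃_conjTranspose σ₃_mul_σ₃, Complex.norm_I, one_mul]
      exact mul_le_mul_of_nonneg_right (hC _) (norm_nonneg _)
    have e3 : ‖dirac p κ (fun y => χ y.1 • u y) y‖ ≤ ‖dirac p κ u y‖ + C * ‖u y‖ := by
      rw [dirac_cutoff hχ hu]
      exact (norm_sub_le _ _).trans (add_le_add e1 e2)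
    have e4 := pow_le_pow_left₀ (norm_nonneg _) e3 2
    nlinarith [sq_nonneg (‖dirac p κ u y‖ - C * ‖u y‖)]
  have a2 : ∫ y, ‖χ y.1 • u y‖ ^ 2 ≤ ∫ y, ‖u y‖ ^ 2 :=
    integral_mono j3 j1 fun y => pow_le_pow_left₀ (norm_nonneg _) (b1 y) 2
  have a3 : ∫ y, ‖dirac p κ (fun y => χ y.1 • u y) y‖ ^ 2
      ≤ 2 * (∫ y, ‖dirac p κ u y‖ ^ 2) + 2 * C ^ 2 * ∫ y, ‖u y‖ ^ 2 := by
    have := integral_mono j4 ((j2.const_mul 2).add (j1.const_mul (2 * C ^ 2))) b2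
    simp only [Pi.add_apply] at this
    rwa [integral_add (j2.const_mul _) (j1.const_mul _), integral_const_mul, integral_const_mul]
      at this
  refine a1.trans (key.trans (add_le_add ?_ le_rfl))
  have n1 : 0 ≤ ∫ y, ‖u y‖ ^ 2 := integral_nonneg fun _ => by positivity
  have n2 : 0 ≤ ∫ y, ‖dirac p κ u y‖ ^ 2 := integral_nonneg fun _ => by positivity
  calc _ ≤ ε / (2 + 2 * C ^ 2) * ((2 + 2 * C ^ 2)
        * ((∫ y, ‖u y‖ ^ 2) + ∫ y, ‖dirac p κ u y‖ ^ 2)) := by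
        refine mul_le_mul_of_nonneg_left ?_ (by positivity)
        nlinarith [mul_nonneg (sq_nonneg C) n2]
    _ = _ := by field_simp

theorem continuous_average_integrand {χ : ℝ → ℝ} (hχ : ContDiff ℝ ∞ χ) {u : ℝ × ℝ → Spinor}
    (hu : IsTest u) : Continuous fun y : ℝ × ℝ => sin y.2 • χ y.1 • u y := by
  have := hχ.continuous
  have := hu.contDiff.continuous
  fun_prop

theorem average_sub {χ : ℝ → ℝ} (hχ : ContDiff ℝ ∞ χ) {u v : ℝ × ℝ → Spinor} (hu : IsTest u)
    (hv : IsTest v) (i : ℕ × ℤ × ℤ) :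
    average χ (fun y => u y - v y) i = average χ u i - average χ v i := by
  unfold average
  have iu : IntegrableOn _ (gridCell i) :=
    (continuous_average_integrand hχ hu).integrableOn_cell _ _ _
  have iv : IntegrableOn _ (gridCell i) :=
    (continuous_average_integrand hχ hv).integrableOn_cell _ _ _
  rw [← integral_sub iu iv]
  simp only [smul_sub]

/-- Cauchy–Schwarz on a square of area at most 1. All averages of an `L²` bounded sequence thus stay
in one ball, whatever the mesh. -/
theorem norm_average_sq_le {χ : ℝ → ℝ} (hχ : ContDiff ℝ ∞ χ) (hle : ∀ x, |χ x| ≤ 1)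
    {u : ℝ × ℝ → Spinor} (hu : IsTest u) (i : ℕ × ℤ × ℤ) :
    ‖average χ u i‖ ^ 2 ≤ ∫ y, ‖u y‖ ^ 2 := by
  have hc := continuous_average_integrand hχ hu
  have hh : (0 : ℝ) < ((i.1 : ℝ) + 1)⁻¹ := by positivity
  have hh1 : ((i.1 : ℝ) + 1)⁻¹ ≤ 1 := inv_le_one_of_one_le₀ (by
    have := i.1.cast_nonneg (α := ℝ)
    linarith)
  have h1 : ‖average χ u i‖ ≤ ∫ y in gridCell i, ‖sin y.2 • χ y.1 • u y‖ :=
    norm_integral_le_integral_norm _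
  have : IsFiniteMeasure ((volume : Measure (ℝ × ℝ)).restrict (gridCell i)) :=
    isFiniteMeasure_restrict_cell _ _ _
  have h2 := sq_integral_le (μ := volume.restrict (gridCell i)) (hc.norm.integrableOn_cell _ _ _)
    ((hc.norm.pow 2).integrableOn_cell _ _ _) (pow_pos hh 2)
    (by rw [measureReal_restrict_apply_univ]; exact volume_real_cell _ _ hh)
  have h3 : ∫ y in gridCell i, ‖sin y.2 • χ y.1 • u y‖ ^ 2 ≤ ∫ y, ‖u y‖ ^ 2 := by
    refine (setIntegral_mono ((hc.norm.pow 2).integrableOn_cell _ _ _)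
      hu.integrable_norm_sq.integrableOn fun y => ?_).trans
        (setIntegral_le_integral hu.integrable_norm_sq (Eventually.of_forall fun _ => by positivity))
    refine pow_le_pow_left₀ (norm_nonneg _) ?_ 2
    rw [norm_smul, norm_smul]
    exact (mul_le_of_le_one_left (by positivity) (abs_sin_le_one _)).trans
      (mul_le_of_le_one_left (norm_nonneg _) (hle _))
  have h4 : (0 : ℝ) ≤ ∫ y in gridCell i, ‖sin y.2 • χ y.1 • u y‖ ^ 2 :=
    integral_nonneg fun _ => by positivity
  calc ‖average χ u i‖ ^ 2 ≤ _ := pow_le_pow_left₀ (norm_nonneg _) h1 2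
    _ ≤ _ := h2
    _ ≤ ∫ y in gridCell i, ‖sin y.2 • χ y.1 • u y‖ ^ 2 :=
        mul_le_of_le_one_left h4 (pow_le_one₀ hh.le hh1)
    _ ≤ _ := h3

/-! ### Equivalence of the `𝒮`-norm with the `L²` norm -/

theorem Lp_norm_sq_eq {U : Set (ℝ × ℝ)} (f : Lp Spinor 2 (volume.restrict U)) :
    ‖f‖ ^ 2 = ∫ y in U, ‖f y‖ ^ 2 := by
  have h := inner_self_eq_norm_sq_to_K (𝕜 := ℂ) f
  rw [L2.inner_def] at h
  simp only [inner_self_eq_norm_sq_to_K] at h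
  norm_cast at h
  exact h.symm

theorem Lp_integrable_norm_sq {U : Set (ℝ × ℝ)} (f : Lp Spinor 2 (volume.restrict U)) :
    Integrable (fun y => ‖f y‖ ^ 2) (volume.restrict U) :=
  (memLp_two_iff_integrable_sq_norm (Lp.aestronglyMeasurable f)).1 (Lp.memLp f)

section NormS

/-- From `Δ ≤ r² + a²` and `a² ≤ M² ≤ r²` it follows that `a² w² ≤ a² / (r² + a²) ≤ 1 / 2`, and `1 /
2 ≤ (3 / 4) ^ 2`. A bound strictly below 1 is what makes `𝒮` uniformly positive. -/
theorem abs_mul_weight_mul_sin_le (p : Params) (hp : p.Admissible) (y : ℝ × ℝ) :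
    |p.a * weight p y.1 * sin y.2| ≤ 3 / 4 := by
  have hr := rPlus_lt_radius p hp y.1
  have h1 := mass_le_rPlus p
  have h2 := Delta_pos p hp hr
  have h3 := Delta_le p hp hr
  have h4 := radius_sq_add_pos p hp y.1
  have h5 : p.a ^ 2 ≤ radius p y.1 ^ 2 := by nlinarith [hp.mass_pos, hp.blackHole, sq_nonneg p.Q]
  have h6 : (p.a * weight p y.1) ^ 2 ≤ (3 / 4) ^ 2 := by
    rw [mul_pow, weight, div_pow, Real.sq_sqrt h2.le, ← mul_div_assoc,
      div_le_iff₀ (by positivity)]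
    have : p.a ^ 2 * Delta p (radius p y.1) ≤ p.a ^ 2 * (radius p y.1 ^ 2 + p.a ^ 2) :=
      mul_le_mul_of_nonneg_left h3 (sq_nonneg _)
    nlinarith
  rw [abs_mul]
  have h7 := abs_le_of_sq_le_sq h6 (by norm_num)
  exact (mul_le_of_le_one_right (abs_nonneg _) (abs_sin_le_one _)).trans h7

theorem re_inner_S (p : Params) (y : ℝ × ℝ) (v : Spinor) :
    (inner ℂ v (act (S p y) v) : ℂ).re
      = ‖v‖ ^ 2 + p.a * weight p y.1 * sin y.2 * (inner ℂ v (act (pm σ₂) v) : ℂ).re := by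
  rw [S, act_add_mat, act_one, act_smul_mat, inner_add_right, inner_smul_right, Complex.add_re,
    Complex.re_ofReal_mul, inner_self_eq_norm_sq_to_K]
  norm_cast

theorem abs_re_inner_S_sub_le (p : Params) (hp : p.Admissible) (y : ℝ × ℝ) (v : Spinor) :
    |(inner ℂ v (act (S p y) v) : ℂ).re - ‖v‖ ^ 2| ≤ 3 / 4 * ‖v‖ ^ 2 := by
  rw [re_inner_S, add_sub_cancel_left, abs_mul]
  refine mul_le_mul (abs_mul_weight_mul_sin_le p hp y) ?_ (abs_nonneg _) (by norm_num)
  calc |(inner ℂ v (act (pm σ₂) v) : ℂ).re| ≤ ‖v‖ * ‖act (pm σ₂) v‖ :=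
        (Complex.abs_re_le_norm _).trans (norm_inner_le_norm _ _)
    _ = ‖v‖ ^ 2 := by rw [norm_act_pm σ₂_conjTranspose σ₂_mul_σ₂, sq]

theorem integrable_re_inner_S (p : Params) (hp : p.Admissible) {U : Set (ℝ × ℝ)}
    (f : Lp Spinor 2 (volume.restrict U)) :
    Integrable (fun y => (inner ℂ (f y) (act (S p y) (f y)) : ℂ).re) (volume.restrict U) := by
  have hf := Lp.aestronglyMeasurable f
  have hw := continuous_weight p hp
  have hm : AEStronglyMeasurable (fun y => (inner ℂ (f y) (act (S p y) (f y)) : ℂ).re)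
      (volume.restrict U) := by
    simp_rw [re_inner_S]
    have h1 : Continuous fun y : ℝ × ℝ => p.a * weight p y.1 * sin y.2 := by fun_prop
    have h2 : Continuous fun v : Spinor => (inner ℂ v (act (pm σ₂) v) : ℂ).re := by
      have := continuous_act (pm σ₂)
      fun_prop
    exact (hf.norm.pow 2).add (h1.aestronglyMeasurable.mul (h2.comp_aestronglyMeasurable hf))
  refine ((Lp_integrable_norm_sq f).const_mul 2).mono' hm (Eventually.of_forall fun y => ?_)
  have := abs_le.1 (abs_re_inner_S_sub_le p hp y (f y))
  rw [Real.norm_eq_abs, abs_le]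
  constructor <;> nlinarith [sq_nonneg ‖f y‖]

/-- The lowest eigenvalue of `𝒮` is at least `1 - 3 / 4 = 1 / 4`, hence the factor `2 = √4`. -/
theorem norm_le_normS (p : Params) (hp : p.Admissible) {U : Set (ℝ × ℝ)}
    (f : Lp Spinor 2 (volume.restrict U)) : ‖f‖ ≤ 2 * normS p U f := by
  have h : ‖f‖ ^ 2 ≤ 4 * ∫ y in U, (inner ℂ (f y) (act (S p y) (f y)) : ℂ).re := by
    rw [Lp_norm_sq_eq, ← integral_const_mul]
    refine integral_mono (Lp_integrable_norm_sq f)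
      ((integrable_re_inner_S p hp f).const_mul 4) fun y => ?_
    have := (abs_le.1 (abs_re_inner_S_sub_le p hp y (f y))).1
    dsimp only
    linarith
  have h0 : 0 ≤ ∫ y in U, (inner ℂ (f y) (act (S p y) (f y)) : ℂ).re := by
    nlinarith [sq_nonneg ‖f‖]
  refine abs_le_of_sq_le_sq' ?_ (mul_nonneg zero_le_two (Real.sqrt_nonneg _)) |>.2
  rw [mul_pow, Real.sq_sqrt h0]
  linarith

theorem normS_le_norm (p : Params) (hp : p.Admissible) {U : Set (ℝ × ℝ)}
    (f : Lp Spinor 2 (volume.restrict U)) : normS p U f ≤ 2 * ‖f‖ := by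
  refine Real.sqrt_le_iff.2 ⟨by positivity, ?_⟩
  rw [mul_pow, Lp_norm_sq_eq, ← integral_const_mul]
  refine integral_mono (integrable_re_inner_S p hp f)
    ((Lp_integrable_norm_sq f).const_mul _) fun y => ?_
  have := (abs_le.1 (abs_re_inner_S_sub_le p hp y (f y))).2
  dsimp only
  nlinarith [sq_nonneg ‖f y‖]

theorem normS_congr_ae (p : Params) {U : Set (ℝ × ℝ)} {f g : ℝ × ℝ → Spinor}
    (h : f =ᵐ[volume.restrict U] g) : normS p U f = normS p U g := by
  unfold normS
  congr 1
  refine integral_congr_ae ?_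
  filter_upwards [h] with y hy
  rw [hy]

end NormS

/-! ### Restriction to `Ω_{2,R}` and extraction of a subsequence -/

theorem restrict_Ω₂R_le (R : ℝ) :
    (volume.restrict (Ω₂R R) : Measure (ℝ × ℝ)) ≤ volume.restrict Ω₂ :=
  Measure.restrict_mono (Set.prod_mono (subset_univ _) Subset.rfl) le_rfl

/-- The restriction of a square integrable function to `Ω_{2,R}`. -/
noncomputable def restrictΩ₂R (R : ℝ) (f : L2) : Lp Spinor 2 (volume.restrict (Ω₂R R)) :=
  ((Lp.memLp f).mono_measure (restrict_Ω₂R_le R)).toLp f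

theorem restrictΩ₂R_coeFn (R : ℝ) (f : L2) :
    restrictΩ₂R R f =ᵐ[volume.restrict (Ω₂R R)] f :=
  MemLp.coeFn_toLp _

theorem norm_restrictΩ₂R_sub_sq (R : ℝ) (f g : L2) :
    ‖restrictΩ₂R R f - restrictΩ₂R R g‖ ^ 2 = ∫ y in Ω₂R R, ‖f y - g y‖ ^ 2 := by
  rw [Lp_norm_sq_eq]
  refine integral_congr_ae ?_
  filter_upwards [restrictΩ₂R_coeFn R f, restrictΩ₂R_coeFn R g,
    Lp.coeFn_sub (restrictΩ₂R R f) (restrictΩ₂R R g)] with y h1 h2 h3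
  rw [h3, Pi.sub_apply, h1, h2]

theorem norm_restrictΩ₂R_sub_le (R : ℝ) (f g : L2) :
    ‖restrictΩ₂R R f - restrictΩ₂R R g‖ ≤ ‖f - g‖ := by
  refine (sq_le_sq₀ (norm_nonneg _) (norm_nonneg _)).1 ?_
  have h1 : ‖f - g‖ ^ 2 = ∫ y in Ω₂, ‖f y - g y‖ ^ 2 := by
    rw [Lp_norm_sq_eq]
    refine integral_congr_ae ?_
    filter_upwards [Lp.coeFn_sub f g] with y h
    rw [h, Pi.sub_apply]
  have h2 : Integrable (fun y => ‖f y - g y‖ ^ 2) (volume.restrict Ω₂) := by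
    refine (Lp_integrable_norm_sq (f - g)).congr ?_
    filter_upwards [Lp.coeFn_sub f g] with y h
    rw [h, Pi.sub_apply]
  rw [norm_restrictΩ₂R_sub_sq, h1]
  exact integral_mono_measure (restrict_Ω₂R_le R) (Eventually.of_forall fun _ => by positivity) h2

theorem IsTest.sub {u v : ℝ × ℝ → Spinor} (hu : IsTest u) (hv : IsTest v) :
    IsTest fun y => u y - v y := by
  have := hu.add (hv.smul (-1))
  have e : u + (-1 : ℂ) • v = fun y => u y - v y := by
    funext y
    simp [sub_eq_add_neg]
  rwa [e] at this

theorem dirac_sub (p : Params) (κ : ℝ) {u v : ℝ × ℝ → Spinor} (hu : IsTest u) (hv : IsTest v)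
    (y : ℝ × ℝ) : dirac p κ (fun y => u y - v y) y = dirac p κ u y - dirac p κ v y := by
  have e : (fun y => u y - v y) = u + (-1 : ℂ) • v := by
    funext y
    simp [sub_eq_add_neg]
  rw [e, dirac_add p κ hu (hv.smul (-1)), dirac_smul p κ _ hv]
  simp [sub_eq_add_neg]

theorem integral_norm_sub_sq_le {f g : ℝ × ℝ → Spinor} (hf : Integrable fun y => ‖f y‖ ^ 2)
    (hg : Integrable fun y => ‖g y‖ ^ 2) :
    ∫ y, ‖f y - g y‖ ^ 2 ≤ 2 * (∫ y, ‖f y‖ ^ 2) + 2 * ∫ y, ‖g y‖ ^ 2 := by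
  rw [← integral_const_mul, ← integral_const_mul,
    ← integral_add (hf.const_mul 2) (hg.const_mul 2)]
  refine integral_mono_of_nonneg (Eventually.of_forall fun _ => by positivity)
    ((hf.const_mul 2).add (hg.const_mul 2)) (Eventually.of_forall fun y => ?_)
  have := pow_le_pow_left₀ (norm_nonneg _) (norm_sub_le (f y) (g y)) 2
  dsimp only
  nlinarith [sq_nonneg (‖f y‖ - ‖g y‖)]

/-- A sequence of test functions bounded in the graph norm has a subsequence whose restrictions
to `Ω_{2,R}` form a Cauchy sequence. -/
theorem exists_subseq_cauchy (p : Params) (hp : p.Admissible) (κ : ℝ) {R : ℝ} (hR : 0 < R)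
    {u : ℕ → ℝ × ℝ → Spinor} (hu : ∀ n, IsTest (u n)) {K : ℝ} (h1 : ∀ n, ∫ y, ‖u n y‖ ^ 2 ≤ K)
    (h2 : ∀ n, ∫ y, ‖dirac p κ (u n) y‖ ^ 2 ≤ K) :
    ∃ ns : ℕ → ℕ, StrictMono ns ∧ ∀ ε > 0, ∃ N, ∀ m ≥ N, ∀ n ≥ N,
      ∫ y in Ω₂R R, ‖u (ns m) y - u (ns n) y‖ ^ 2 < ε := by
  obtain ⟨χ, hχ, hχ1, hχle, hχ0, C, hC⟩ := exists_cutoff hR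
  -- Tychonoff's theorem replaces a diagonal argument: the index set is countable, so the compact
  -- product is sequentially compact, and one subsequence serves all meshes and hence every `ε`.
  have hcomp : IsCompact (univ.pi fun _ : ℕ × ℤ × ℤ => Metric.closedBall (0 : Spinor) √K) :=
    isCompact_univ_pi fun _ => isCompact_closedBall _ _
  obtain ⟨a, -, ns, hns, hlim⟩ := hcomp.tendsto_subseq (x := fun n => average χ (u n)) (by
    intro n i _
    rw [mem_closedBall_zero_iff]
    exact Real.le_sqrt_of_sq_le ((norm_average_sq_le hχ hχle (hu n) i).trans (h1 n)))
  refine ⟨ns, hns, fun ε hε => ?_⟩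
  have hK : 0 ≤ K := (integral_nonneg fun _ => by positivity).trans (h1 0)
  -- For a difference of two members of the sequence each of the two integrals is at most `4 * K`,
  -- so their sum is at most `8 * K`; the added 1 keeps the denominator positive when `K = 0`.
  obtain ⟨s, c, hc, hs⟩ := exists_setIntegral_norm_sq_le_averages p hp κ hχ hχ1 hχle hχ0 hC
    (ε := ε / (2 * (8 * K + 1))) (by positivity)
  have hlim2 : Tendsto (fun q : ℕ × ℕ => c * ∑ i ∈ s,
      ‖average χ (u (ns q.1)) i - average χ (u (ns q.2)) i‖ ^ 2) (atTop ×ˢ atTop) (𝓝 0) := by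
    have hi : ∀ i, Tendsto (fun q : ℕ × ℕ =>
        ‖average χ (u (ns q.1)) i - average χ (u (ns q.2)) i‖ ^ 2) (atTop ×ˢ atTop) (𝓝 0) := by
      intro i
      have h := (tendsto_pi_nhds.1 hlim) i
      have := (((h.comp tendsto_fst).sub (h.comp tendsto_snd)).norm).pow 2
      simpa using this
    simpa using (tendsto_finsetSum s fun i _ => hi i).const_mul c
  rw [prod_atTop_atTop_eq] at hlim2
  obtain ⟨⟨N₁, N₂⟩, hN⟩ := eventually_atTop.1 (hlim2.eventually_lt_const (half_pos hε))
  refine ⟨max N₁ N₂, fun m hm n hn => ?_⟩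
  have hsm := hN (m, n) ⟨(le_max_left _ _).trans hm, (le_max_right _ _).trans hn⟩
  have hd := (hu (ns m)).sub (hu (ns n))
  have b := hs _ hd
  simp only [dirac_sub p κ (hu (ns m)) (hu (ns n)),
    average_sub hχ (hu (ns m)) (hu (ns n))] at b
  have c1 := integral_norm_sub_sq_le (hu (ns m)).integrable_norm_sq (hu (ns n)).integrable_norm_sq
  have c2 := integral_norm_sub_sq_le ((hu (ns m)).integrable_norm_dirac_sq p hp κ)
    ((hu (ns n)).integrable_norm_dirac_sq p hp κ)
  have c3 := h1 (ns m)
  have c4 := h1 (ns n)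
  have c5 := h2 (ns m)
  have c6 := h2 (ns n)
  have c7 : ε / (2 * (8 * K + 1)) * ((∫ y, ‖u (ns m) y - u (ns n) y‖ ^ 2)
      + ∫ y, ‖dirac p κ (u (ns m)) y - dirac p κ (u (ns n)) y‖ ^ 2) ≤ ε / 2 := by
    calc _ ≤ ε / (2 * (8 * K + 1)) * (8 * K + 1) := by
          refine mul_le_mul_of_nonneg_left ?_ (by positivity)
          linarith
      _ = ε / 2 := by field_simp
  linarith

/-- The `L²` norm over the plane of a test function is its norm in `L²(Ω₂)`. -/
theorem integral_norm_sq_eq {f : L2} {v w : ℝ × ℝ → Spinor} (hv : IsTest v)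
    (h0 : ∀ y, y ∉ tsupport v → w y = 0) (h : f =ᵐ[volume.restrict Ω₂] w) :
    ∫ y, ‖w y‖ ^ 2 = ‖f‖ ^ 2 := by
  rw [Lp_norm_sq_eq, ← setIntegral_eq_integral_of_forall_compl_eq_zero (s := Ω₂) fun y hy => by
    simp [h0 y fun h' => hy (hv.tsupport_subset h')]]
  refine integral_congr_ae ?_
  filter_upwards [h] with y hy
  rw [hy]

end KerrNewman

/-! ### The Rellich property for the closure -/

theorem mainTheorem4 (p : KerrNewman.Params) (hp : p.Admissible)
    (κ : ℝ) (hκ : ∃ k : ℤ, κ = k + 1 / 2) (R : ℝ) (hR : 0 < R)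
    (Ψ : ℕ → (KerrNewman.diracOp p κ).domain) (K₀ : ℝ) (hK₀ : 0 < K₀)
    (hΨ : ∀ n, KerrNewman.normS p KerrNewman.Ω₂ (Ψ n : KerrNewman.L2)
      + KerrNewman.normS p KerrNewman.Ω₂ (KerrNewman.diracOp p κ (Ψ n)) ≤ K₀) :
    ∃ ns : ℕ → ℕ, StrictMono ns ∧
      ∃ Φ : Lp KerrNewman.Spinor 2 (volume.restrict (KerrNewman.Ω₂R R)),
        Tendsto (fun l => KerrNewman.normS p (KerrNewman.Ω₂R R)
          (fun y => (Ψ (ns l) : KerrNewman.L2) y - Φ y)) atTop (𝓝 0) := by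
  open KerrNewman in
  -- The graph of the operator is the closure of the graph on test functions. Errors tending to zero
  -- ensure that the approximants and the original sequence share their limits on `Ω_{2,R}`.
  have happrox : ∀ n : ℕ, ∃ f ∈ minimalGraph p κ, dist ((Ψ n : L2), diracOp p κ (Ψ n)) f
      < 1 / ((n : ℝ) + 1) := by
    intro n
    have hmem : ((Ψ n : L2), diracOp p κ (Ψ n)) ∈ (minimalGraph p κ).topologicalClosure := by
      rw [← diracOp_graph p hp κ]
      exact (diracOp p κ).mem_graph (Ψ n)
    exact Metric.mem_closure_iff.1 hmem _ (by positivity)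
  choose f hf hdist using happrox
  choose u hu hu1 hu2 using hf
  have hn1 : ∀ n : ℕ, 1 / ((n : ℝ) + 1) ≤ 1 := fun n => by
    rw [div_le_one (by positivity)]
    linarith [n.cast_nonneg (α := ℝ)]
  have hd1 : ∀ n, ‖(Ψ n : L2) - (f n).1‖ ≤ 1 / ((n : ℝ) + 1) := fun n => by
    rw [← dist_eq_norm]
    exact (le_max_left _ _).trans (hdist n).le
  have hd2 : ∀ n, ‖diracOp p κ (Ψ n) - (f n).2‖ ≤ 1 / ((n : ℝ) + 1) := fun n => by
    rw [← dist_eq_norm]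
    exact (le_max_right _ _).trans (hdist n).le
  -- The factor 2 is the cost of passing from the `𝒮`-norm to the `L²` norm, and 1 bounds the
  -- approximation error.
  have hb1 : ∀ n, ‖(f n).1‖ ≤ 2 * K₀ + 1 := fun n => by
    have h1 := norm_le_normS p hp (Ψ n : L2)
    have h2 : 0 ≤ normS p Ω₂ (diracOp p κ (Ψ n)) := Real.sqrt_nonneg _
    have h3 := norm_sub_norm_le (f n).1 (Ψ n : L2)
    rw [norm_sub_rev] at h3
    linarith [hΨ n, hd1 n, hn1 n]
  have hb2 : ∀ n, ‖(f n).2‖ ≤ 2 * K₀ + 1 := fun n => by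
    have h1 := norm_le_normS p hp (diracOp p κ (Ψ n))
    have h2 : 0 ≤ normS p Ω₂ (Ψ n : L2) := Real.sqrt_nonneg _
    have h3 := norm_sub_norm_le (f n).2 (diracOp p κ (Ψ n))
    rw [norm_sub_rev] at h3
    linarith [hΨ n, hd2 n, hn1 n]
  obtain ⟨ns, hns, hcau⟩ := exists_subseq_cauchy p hp κ hR hu (K := (2 * K₀ + 1) ^ 2)
    (fun n => by
      rw [integral_norm_sq_eq (hu n) (fun y hy => IsTest.eq_zero hy) (hu1 n)]
      exact pow_le_pow_left₀ (norm_nonneg _) (hb1 n) 2)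
    (fun n => by
      rw [integral_norm_sq_eq (hu n) (fun y hy => dirac_eq_zero p κ hy) (hu2 n)]
      exact pow_le_pow_left₀ (norm_nonneg _) (hb2 n) 2)
  have hseq : CauchySeq fun l => restrictΩ₂R R (f (ns l)).1 := by
    rw [Metric.cauchySeq_iff]
    intro ε hε
    obtain ⟨N, hN⟩ := hcau (ε ^ 2) (by positivity)
    refine ⟨N, fun m hm n hn => ?_⟩
    rw [dist_eq_norm, ← sq_lt_sq₀ (norm_nonneg _) hε.le, norm_restrictΩ₂R_sub_sq]
    refine lt_of_eq_of_lt (integral_congr_ae ?_) (hN m hm n hn)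
    filter_upwards [(hu1 (ns m)).filter_mono (ae_mono (restrict_Ω₂R_le R)),
      (hu1 (ns n)).filter_mono (ae_mono (restrict_Ω₂R_le R))] with y e1 e2
    rw [e1, e2]
  obtain ⟨Φ, hΦ⟩ := cauchySeq_tendsto_of_complete hseq
  refine ⟨ns, hns, Φ, ?_⟩
  -- Triangle inequality through the approximating test function, after replacing the `𝒮`-norm by
  -- twice the `L²` norm.
  have hle : ∀ l, normS p (Ω₂R R) (fun y => (Ψ (ns l) : L2) y - Φ y)
      ≤ 2 * (1 / ((ns l : ℝ) + 1) + ‖restrictΩ₂R R (f (ns l)).1 - Φ‖) := by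
    intro l
    have e : (fun y => (Ψ (ns l) : L2) y - Φ y) =ᵐ[volume.restrict (Ω₂R R)]
        (restrictΩ₂R R (Ψ (ns l) : L2) - Φ : Lp Spinor 2 (volume.restrict (Ω₂R R))) := by
      filter_upwards [restrictΩ₂R_coeFn R (Ψ (ns l) : L2),
        Lp.coeFn_sub (restrictΩ₂R R (Ψ (ns l) : L2)) Φ] with y e1 e2
      rw [e2, Pi.sub_apply, e1]
    rw [normS_congr_ae p e]
    refine (normS_le_norm p hp _).trans (mul_le_mul_of_nonneg_left ?_ zero_le_two)
    refine (norm_sub_le_norm_sub_add_norm_sub _ (restrictΩ₂R R (f (ns l)).1) _).trans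
      (add_le_add ((norm_restrictΩ₂R_sub_le R _ _).trans (hd1 (ns l))) le_rfl)
  refine squeeze_zero (fun l => Real.sqrt_nonneg _) hle ?_
  have t1 : Tendsto (fun l => 1 / ((ns l : ℝ) + 1)) atTop (𝓝 0) :=
    tendsto_one_div_add_atTop_nhds_zero_nat.comp hns.tendsto_atTop
  have t2 := tendsto_iff_norm_sub_tendsto_zero.1 hΦ
  simpa using (t1.add t2).const_mul 2
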